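/- A normal form game $G_k$ has $k\ge 1$ players with $n\ge 1$ pure strategies each, and for each player $i$ and each pure strategy profile $s\in[n]^k$ a rational payoff in $[0,1]$. Let $\mathrm{ent}(G_k)=k\,n^k$ be its number of payoff entries, and let $|G_k|$ be the bit length of a given explicit description of it ($k$, $n$, and all payoffs as fractions of natural numbers in binary). Given mixed strategies $p^1,\dots,p^k$, let $u^i[j]$ be the expected payoff of player $i$ for the pure strategy $j$ when the other players play $p^{-i}$. For $\epsilon>0$, the profile $(p^1,\dots,p^k)$ is an $\epsilon$-well-supported Nash equilibrium if $p^i_j>0$ implies $u^i[j]\ge u^i[j']-\epsilon$ for all $i,j,j'$. A mapping from $G_k$ to a bimatrix game $G_2$ with $N$ pure strategies per player consists of a function $g:[k]\to[2]$ and injective functions $h_i:[n]\to[N]$ for $i\in[k]$. It is a direct reduction from $(G_k,\epsilon_k)$ to $(G_2,\epsilon_2)$ if for every $\epsilon_2$-well-supported Nash equilibrium $(q^1,q^2)$ of $G_2$ the sums $z_i=\sum_j q^{g(i)}[h_i(j)]$ are positive, and $p^i[j]=q^{g(i)}[h_i(j)]/z_i$ defines an $\epsilon_k$-well-supported Nash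 equilibrium $(p^1,\dots,p^k)$ of $G_k$. **Theorem.** There are a deterministic algorithm, a polynomial $T$, and constants $c>0$ and $d\in\mathbb{N}$, $d\ge 1$, such that the following holds for all $k,n\ge 1$, every normal form game $G_k$ with $k$ players and $n$ pure strategies each, every explicit description of $G_k$, and every real $\epsilon_k$ with $0<\epsilon_k<1$. Given the description of $G_k$ and the number of bits of accuracy $\lceil\log_2(1/\epsilon_k)\rceil$, the algorithm outputs an explicit description of a bimatrix game $G_2$ with rational payoffs in $[0,1]$, a rational number $\epsilon_2$ (as a fraction of natural numbers in binary) with $$c\,\Big(\frac{\epsilon_k}{\mathrm{ent}(G_k)}\Big)^{d}\;\le\;\epsilon_2\;\le\;\Big(\frac{\epsilon_k}{\mathrm{ent}(G_k)}\Big)^{d},$$ and a mapping $(g,(h_i)_i)$ from $G_k$ to $G_2$ that is a direct reduction from $(G_k,\epsilon_k)$ to $(G_2,\epsilon_2)$. The running time is at most $T\big(|G_k|+\lceil\log_2(1/\epsilon_k)\rceil\big)$. Here running time is the bit cost of a program in a while-language over binary trees with natural numbers at the leaves, where each operation ($+$, truncated $-$, $\times$, integer division, pairing, projection, constants, test for zero)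 is charged the bit size of the values it reads and writes; this is polynomially related to time on a Turing machine. -/

import Mathlib

/-! ### Normal form games and approximate equilibria -/

/-- A normal form game with `k` players and `n` pure strategies per player. `payoff i s` is the
payoff of player `i` under the pure strategy profile `s`, i.e. the entry `M^i[s i, s^{-i}]`. -/
structure NormalFormGame (k n : ℕ) where
  payoff : Fin k → (Fin k → Fin n) → ℚ
  payoff_mem : ∀ i s, 0 ≤ payoff i s ∧ payoff i s ≤ 1

namespace NormalFormGame

variable {k n : ℕ}

/-- The number `k * n ^ k` of payoff entries of the game. -/
def entries (_G : NormalFormGame k n) : ℕ := k * n ^ k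

/-- Expected payoff of player `i` for the pure strategy `j` while the others play `p`: the sum over
the profiles `s` with `s i = j` of the payoff times the probability of `s^{-i}`. -/
noncomputable def expectedPayoff (G : NormalFormGame k n) (p : Fin k → Fin n → ℝ)
    (i : Fin k) (j : Fin n) : ℝ :=
  ∑ s : Fin k → Fin n with s i = j, (G.payoff i s : ℝ) * ∏ i' ∈ Finset.univ.erase i, p i' (s i')

/-- `p` is an `ε`-well-supported Nash equilibrium: a profile of mixed strategies whose supports
contain only `ε`-best responses. -/
def IsWellSupportedNash (G : NormalFormGame k n) (ε : ℝ) (p : Fin k → Fin n → ℝ) : Prop :=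
  (∀ i, p i ∈ stdSimplex ℝ (Fin n)) ∧
    ∀ i j, 0 < p i j → ∀ j', G.expectedPayoff p i j' ≤ G.expectedPayoff p i j + ε

end NormalFormGame

/-! ### Mappings between games and direct reductions -/

/-- A mapping from a game with `k` players and `n` strategies each to a game with `m` players and
`N` strategies each. -/
structure GameMapping (k n m N : ℕ) where
  g : Fin k → Fin m
  h : Fin k → Fin n → Fin N
  h_injective : ∀ i, Function.Injective (h i)

namespace GameMapping

variable {k n m N : ℕ}

/-- Renormalization `p^i[j] = (1/z) q^{g(i)}[h_i(j)]`. If `z = 0`, the result is the zero vector,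
which is not a mixed strategy. -/
noncomputable def renormalize (φ : GameMapping k n m N) (q : Fin m → Fin N → ℝ) :
    Fin k → Fin n → ℝ :=
  fun i j => q (φ.g i) (φ.h i j) / ∑ j', q (φ.g i) (φ.h i j')

/-- `φ` is a direct reduction from `(G, ε)` to `(G', ε')`. -/
def IsDirectReduction (φ : GameMapping k n m N) (G : NormalFormGame k n) (ε : ℝ)
    (G' : NormalFormGame m N) (ε' : ℝ) : Prop :=
  ∀ q, G'.IsWellSupportedNash ε' q → G.IsWellSupportedNash ε (φ.renormalize q)

end GameMapping

/-! ### The model of computation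

A structured while-language whose values are binary trees with natural numbers at the leaves.
Time is bit cost: each operation and each copy of a value is charged the bit size of the values
that it reads and writes. All basic operations are computable in polynomial time on a Turing
machine, and a Turing machine step is computable with constantly many operations, so that
polynomial time in this model is polynomial time on Turing machines. -/

inductive Data where
  | nat : ℕ → Data
  | pair : Data → Data → Data

namespace Data

/-- Bit size. -/
def size : Data → ℕ
  | nat a => a.size + 1
  | pair u v => u.size + v.size + 1

/-- Lists as nested pairs, ended by the leaf `0`. -/
def list : List Data → Data
  | [] => nat 0
  | u :: l => pair u (list l)

end Data

/-- Basic operations. -/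
inductive Op where
  | copy
  | const (c : Data)
  | fst
  | snd
  | add
  | sub
  | mul
  | div

namespace Op

/-- Value of a basic operation (`0` on arguments of the wrong form; `sub` is truncated, and `div`
rounds down, with `a / 0 = 0`). -/
def eval : Op → Data → Data
  | copy, u => u
  | const c, _ => c
  | fst, .pair u _ => u
  | snd, .pair _ v => v
  | add, .pair (.nat a) (.nat b) => .nat (a + b)
  | sub, .pair (.nat a) (.nat b) => .nat (a - b)
  | mul, .pair (.nat a) (.nat b) => .nat (a * b)
  | div, .pair (.nat a) (.nat b) => .nat (a / b)
  | _, _ => .nat 0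

end Op

/-- Programs. -/
inductive Prog where
  | op (o : Op)
  | seq (P Q : Prog)
  | pair (P Q : Prog)
  | ite (C P Q : Prog)
  | loop (C P : Prog)

/-- `P.Runs u v t`: on input `u` the program `P` halts with output `v` in time `t`.
`seq P Q` runs `P` and then `Q`; `pair P Q` runs both on the same input; `ite C P Q` runs `P` or
`Q` according to whether `C` yields a value other than the leaf `0`; `loop C P` applies `P` as long
as `C` yields a value other than the leaf `0`. -/
inductive Prog.Runs : Prog → Data → Data → ℕ → Prop where
  | op (o : Op) (u : Data) : Prog.Runs (.op o) u (o.eval u) (u.size + (o.eval u).size)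
  | seq {P Q : Prog} {u v w : Data} {s t : ℕ} :
      Prog.Runs P u v s → Prog.Runs Q v w t → Prog.Runs (.seq P Q) u w (s + t + 1)
  | pair {P Q : Prog} {u v w : Data} {s t : ℕ} :
      Prog.Runs P u v s → Prog.Runs Q u w t →
        Prog.Runs (.pair P Q) u (.pair v w) (s + t + u.size + (Data.pair v w).size)
  | iteTrue {C P Q : Prog} {u b v : Data} {s t : ℕ} :
      Prog.Runs C u b s → b ≠ .nat 0 → Prog.Runs P u v t →
        Prog.Runs (.ite C P Q) u v (s + t + u.size)
  | iteFalse {C P Q : Prog} {u v : Data} {s t : ℕ} :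
      Prog.Runs C u (.nat 0) s → Prog.Runs Q u v t →
        Prog.Runs (.ite C P Q) u v (s + t + u.size)
  | loopDone {C P : Prog} {u : Data} {s : ℕ} :
      Prog.Runs C u (.nat 0) s → Prog.Runs (.loop C P) u u (s + u.size)
  | loopStep {C P : Prog} {u b v w : Data} {s t r : ℕ} :
      Prog.Runs C u b s → b ≠ .nat 0 → Prog.Runs P u v t → Prog.Runs (.loop C P) v w r →
        Prog.Runs (.loop C P) u w (s + t + r + u.size)

/-! ### Descriptions of games, accuracies and mappings as data -/

/-- `x` is a fraction `a / b` of natural numbers in binary, with value `r`. -/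
def IsRatCode (r : ℚ) (x : Data) : Prop :=
  ∃ a b : ℕ, 0 < b ∧ r = (a : ℚ) / (b : ℚ) ∧ x = .pair (.nat a) (.nat b)

/-- `x` is an explicit description of the game `G`: the numbers `k` and `n`, and for each player
the table of the payoffs of all `n ^ k` profiles, where the profile `s` has index
`∑ i, s i * n ^ i`. -/
def IsGameCode {k n : ℕ} (G : NormalFormGame k n) (x : Data) : Prop :=
  ∃ entry : Fin k → (Fin k → Fin n) → Data, (∀ i s, IsRatCode (G.payoff i s) (entry i s)) ∧
    x = .pair (.nat k) (.pair (.nat n) (.list (List.ofFn fun i : Fin k =>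
      .list (List.ofFn fun l : Fin (n ^ k) => entry i (finFunctionFinEquiv.symm l)))))

/-- The list over the players `i` of `g i` and the list of the values of `h i`. -/
def GameMapping.code {k n m N : ℕ} (φ : GameMapping k n m N) : Data :=
  .list (List.ofFn fun i : Fin k => .pair (.nat (φ.g i))
    (.list (List.ofFn fun j : Fin n => .nat (φ.h i j))))

/-- `⌈log₂ (1/ε)⌉`, the number of bits of accuracy. -/
noncomputable def accuracyBits (ε : ℝ) : ℕ := ⌈Real.logb 2 (1 / ε)⌉₊

/-! The bimatrix game simulates an arithmetic circuit for the expected payoffs of the given game.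
The column player is paid for matching the row player, so his support lies inside the row player's
support. Hence his mixed strategy `y` is an approximate best response to itself under the row
payoffs (`isSelfResponse_of_isWellSupportedNash`), and every player of the given game is mapped to
the column player.

Strategies are grouped into `K` blocks, one per player and one per gate. The row payoff is a bonus,
linear in `y`, minus `M` times the mass of the own block. A large `M` forces every block to have
mass close to `1 / K` (`abs_card_mul_blockMass_sub_one_le`). Inside a block the penalty is constant
and only bonuses compete. A gate has two strategies, one with bonus `0` and one with bonus `L - x`,
where `x` is `K` times the mass of the second. Equilibrium then forces `x` to be about `L` truncated
to `[0, 1]` (`abs_sub_unitClamp_le`). Two such gates, for `L` and `-L`, give `min 1 |L|`.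

Truncated absolute values suffice for multiplication. Iterating `z ^ 2 = z - 1 / 4 + |2 * z - 1| ^ 2
/ 4` gives a series that converges like `4 ^ (-R)` and is stable under errors, and a product is a
difference of two squares (`abs_sum_iterates_sub_mul_le`). So `R` iterates, logarithmic in the
required precision up to polynomial slack, multiply the probabilities in a profile one factor at a
time. The bonus of the strategy `(i, j)` adds up these products weighted by payoffs and approximates
the expected payoff (`abs_sum_bonus_sub_utility_le`), so players use only approximate best responses
(`utility_le`).

The exponent `8` comes from `H = W * 2 ^ b`: gates need precision `1 / H`, `K` is `O(H ^ 3)`, so `M`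
of order `H ^ 7` bounds `K ^ 2 * H`, and dividing the precision by `M` gives `H ^ (-8)`. Running
time is polynomial because an explicit description is at least as long as the number `W` of entries
(`W_le_inputSize`), and each payoff has a closed formula in the digits of its index. -/

/-! ### Polynomial time for families of computations -/

/-- `f` is bounded by a polynomial in `s`. -/
def PolyBdd {α : Type} (s f : α → ℕ) : Prop := ∃ T : Polynomial ℕ, ∀ a, f a ≤ T.eval (s a)

namespace PolyBdd

variable {α β : Type} {s f g : α → ℕ}

theorem mono (hg : PolyBdd s g) (h : ∀ a, f a ≤ g a) : PolyBdd s f :=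
  let ⟨T, hT⟩ := hg
  ⟨T, fun a => (h a).trans (hT a)⟩

theorem const (c : ℕ) : PolyBdd s fun _ => c := ⟨.C c, fun a => by simp⟩

theorem self : PolyBdd s s := ⟨.X, fun a => by simp⟩

theorem add (hf : PolyBdd s f) (hg : PolyBdd s g) : PolyBdd s fun a => f a + g a :=
  let ⟨T, hT⟩ := hf
  let ⟨U, hU⟩ := hg
  ⟨T + U, fun a => by simpa using Nat.add_le_add (hT a) (hU a)⟩

theorem mul (hf : PolyBdd s f) (hg : PolyBdd s g) : PolyBdd s fun a => f a * g a :=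
  let ⟨T, hT⟩ := hf
  let ⟨U, hU⟩ := hg
  ⟨T * U, fun a => by simpa using Nat.mul_le_mul (hT a) (hU a)⟩

theorem sub (hf : PolyBdd s f) : PolyBdd s fun a => f a - g a :=
  hf.mono fun _ => Nat.sub_le _ _

theorem div (hf : PolyBdd s f) : PolyBdd s fun a => f a / g a :=
  hf.mono fun _ => Nat.div_le_self _ _

theorem mod (hf : PolyBdd s f) : PolyBdd s fun a => f a % g a :=
  hf.mono fun _ => Nat.mod_le _ _

theorem ite {c : α → Prop} [∀ a, Decidable (c a)] (hf : PolyBdd s f) (hg : PolyBdd s g) :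
    PolyBdd s fun a => if c a then f a else g a :=
  (hf.add hg).mono fun a => by split_ifs <;> simp

theorem comap (π : β → α) (hf : PolyBdd s f) :
    PolyBdd (fun b => s (π b)) (fun b => f (π b)) :=
  let ⟨T, hT⟩ := hf
  ⟨T, fun b => hT (π b)⟩

end PolyBdd

/-! ### Bit sizes and their growth. -/

namespace Data

theorem size_pos (u : Data) : 0 < u.size := by cases u <;> simp [size]

@[simp] theorem size_nat (a : ℕ) : (nat a).size = a.size + 1 := rfl

@[simp] theorem size_pair (u v : Data) : (pair u v).size = u.size + v.size + 1 := rfl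

theorem size_list (l : List Data) : (list l).size = (l.map size).sum + l.length + 1 := by
  induction l with
  | nil => simp [list]
  | cons u l ih => simp [list, ih]; omega

end Data

theorem Nat.size_le_self (a : ℕ) : a.size ≤ a := Nat.size_le.2 Nat.lt_two_pow_self

theorem Nat.size_add_le (a b : ℕ) : (a + b).size ≤ a.size + b.size + 1 := by
  rw [Nat.size_le]
  have ha := Nat.lt_size_self a
  have hb := Nat.lt_size_self b
  have h1 : 2 ^ a.size ≤ 2 ^ (a.size + b.size) := Nat.pow_le_pow_right (by simp) (by omega)
  have h2 : 2 ^ b.size ≤ 2 ^ (a.size + b.size) := Nat.pow_le_pow_right (by simp) (by omega)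
  rw [pow_succ]
  omega

theorem Nat.size_mul_le (a b : ℕ) : (a * b).size ≤ a.size + b.size := by
  rw [Nat.size_le, pow_add]
  exact Nat.mul_lt_mul'' (Nat.lt_size_self a) (Nat.lt_size_self b)

theorem Nat.size_pow_le (a b : ℕ) : (a ^ b).size ≤ b * a.size + 1 := by
  induction b with
  | zero => simp
  | succ b ih =>
    rw [pow_succ, add_mul, one_mul]
    have := Nat.size_mul_le (a ^ b) a
    omega

namespace Op

/-- A bound for the growth of the bit size under a basic operation. -/
def growth : Op → ℕ
  | const c => c.size
  | _ => 1

theorem size_eval_le (o : Op) (u : Data) : (o.eval u).size ≤ u.size + o.growth := by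
  have h0 := u.size_pos
  cases o with
  | copy => simp [eval, growth]
  | const c => simp [eval, growth]
  | fst => rcases u with a | ⟨u, v⟩ <;> simp [eval, growth]; omega
  | snd => rcases u with a | ⟨u, v⟩ <;> simp [eval, growth]; omega
  | add =>
    rcases u with a | ⟨_ | _, _ | _⟩ <;> simp [eval, growth]
    rename_i a b
    have := Nat.size_add_le a b
    omega
  | sub =>
    rcases u with a | ⟨_ | _, _ | _⟩ <;> simp [eval, growth]
    rename_i a b
    have := Nat.size_le_size (Nat.sub_le a b)
    omega
  | mul =>
    rcases u with a | ⟨_ | _, _ | _⟩ <;> simp [eval, growth]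
    rename_i a b
    have := Nat.size_mul_le a b
    omega
  | div =>
    rcases u with a | ⟨_ | _, _ | _⟩ <;> simp [eval, growth]
    rename_i a b
    have := Nat.size_le_size (Nat.div_le_self a b)
    omega

end Op

/-- Every rule charges for what it reads and writes, so a time bound is also a bound on the sizes of
input and output. Thus `PolyTime` carries its own size bounds through compositions. -/
theorem Prog.Runs.size_le {P : Prog} {u v : Data} {t : ℕ} (h : P.Runs u v t) :
    u.size ≤ t ∧ v.size ≤ t := by
  induction h <;> constructor <;> omega

/-! ### A calculus of polynomial-time computations. -/

/-- A single program computes `f a` from `e a` for all `a`, in time polynomial in `s a`. -/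
def PolyTime {α : Type} (s : α → ℕ) (e f : α → Data) : Prop :=
  ∃ (P : Prog) (τ : α → ℕ), PolyBdd s τ ∧ ∀ a, P.Runs (e a) (f a) (τ a)

namespace PolyTime

variable {α β : Type} {s : α → ℕ} {e f g h : α → Data} {m : α → ℕ}

theorem size_input (hf : PolyTime s e f) : PolyBdd s fun a => (e a).size :=
  let ⟨_, _, hτ, hP⟩ := hf
  hτ.mono fun a => (hP a).size_le.1

theorem size_output (hf : PolyTime s e f) : PolyBdd s fun a => (f a).size :=
  let ⟨_, _, hτ, hP⟩ := hf
  hτ.mono fun a => (hP a).size_le.2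

theorem of_eq (hf : PolyTime s e f) (hfg : ∀ a, f a = g a) : PolyTime s e g :=
  (funext hfg : f = g) ▸ hf

theorem comap (π : β → α) (hf : PolyTime s e f) :
    PolyTime (fun b => s (π b)) (fun b => e (π b)) (fun b => f (π b)) :=
  let ⟨P, _, hτ, hP⟩ := hf
  ⟨P, _, hτ.comap π, fun b => hP (π b)⟩

theorem refl (he : PolyBdd s fun a => (e a).size) : PolyTime s e e :=
  ⟨.op .copy, _, he.add he, fun a => .op .copy (e a)⟩

theorem comp (hf : PolyTime s e f) (hg : PolyTime s f g) : PolyTime s e g :=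
  let ⟨P, _, hτ, hP⟩ := hf
  let ⟨Q, _, hσ, hQ⟩ := hg
  ⟨.seq P Q, _, (hτ.add hσ).add (.const 1), fun a => .seq (hP a) (hQ a)⟩

theorem pair (hf : PolyTime s e f) (hg : PolyTime s e g) :
    PolyTime s e fun a => .pair (f a) (g a) :=
  let ⟨P, _, hτ, hP⟩ := hf
  let ⟨Q, _, hσ, hQ⟩ := hg
  ⟨.pair P Q, _, ((hτ.add hσ).add hf.size_input).add
    ((hf.size_output.add hg.size_output).add (.const 1)), fun a => .pair (hP a) (hQ a)⟩

theorem op (o : Op) (hf : PolyTime s e f) : PolyTime s e fun a => o.eval (f a) :=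
  hf.comp ⟨.op o, _, hf.size_output.add ((hf.size_output.add (.const o.growth)).mono
    fun a => o.size_eval_le (f a)), fun a => .op o (f a)⟩

theorem const (c : Data) (hf : PolyTime s e f) : PolyTime s e fun _ => c := op (.const c) hf

theorem fst (hf : PolyTime s e fun a => .pair (f a) (g a)) : PolyTime s e f := op .fst hf

theorem snd (hf : PolyTime s e fun a => .pair (f a) (g a)) : PolyTime s e g := op .snd hf

theorem ite_ne_zero {c : α → ℕ} (hc : PolyTime s e fun a => .nat (c a)) (hf : PolyTime s e f)
    (hg : PolyTime s e g) : PolyTime s e fun a => if c a ≠ 0 then f a else g a := by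
  obtain ⟨C, ρ, hρ, hC⟩ := hc
  obtain ⟨P, τ, hτ, hP⟩ := hf
  obtain ⟨Q, σ, hσ, hQ⟩ := hg
  refine ⟨.ite C P Q, fun a => ρ a + (if c a ≠ 0 then τ a else σ a) + (e a).size,
    (hρ.add (hτ.ite hσ)).add (hρ.mono fun a => (hC a).size_le.1), fun a => ?_⟩
  by_cases h0 : c a = 0
  · have hCa : C.Runs (e a) (.nat (c a)) (ρ a) := hC a
    rw [h0] at hCa
    simpa [h0] using hCa.iteFalse (P := P) (hQ a)
  · simpa [h0] using (hC a).iteTrue (Q := Q) (by simpa using h0) (hP a)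

/-- A loop that runs through the states `st a (m a), …, st a 0` of a counter. -/
theorem loop (hm : PolyBdd s m) (st : α → ℕ → Data)
    (hC : PolyTime (fun p : Σ a, Fin (m a + 1) => s p.1) (fun p => st p.1 p.2)
      fun p => .nat p.2)
    (hB : PolyTime (fun p : Σ a, Fin (m a) => s p.1) (fun p => st p.1 (p.2 + 1))
      fun p => st p.1 p.2) :
    PolyTime s (fun a => st a (m a)) fun a => st a 0 := by
  obtain ⟨C, ρ, ⟨T, hT⟩, hC⟩ := hC
  obtain ⟨B, τ, ⟨U, hU⟩, hB⟩ := hB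
  -- A pass pays for the test, the body and the size of the state. The last is at most the time of
  -- the test, hence `2 * T + U` per pass.
  have key : ∀ a, ∀ j ≤ m a, ∃ t, (Prog.loop C B).Runs (st a j) (st a 0) t ∧
      t ≤ (j + 1) * (2 * T.eval (s a) + U.eval (s a)) := by
    intro a j
    induction j with
    | zero =>
      intro _
      have h0 := hC ⟨a, 0, Nat.succ_pos _⟩
      have h1 := hT ⟨a, 0, Nat.succ_pos _⟩
      have h2 := h0.size_le.1
      refine ⟨_, .loopDone h0, ?_⟩
      simp only at h1 h2 ⊢
      omega
    | succ j ih =>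
      intro hj
      obtain ⟨t, ht, ht'⟩ := ih (by omega)
      have h0 := hC ⟨a, j + 1, by omega⟩
      have h1 := hT ⟨a, j + 1, by omega⟩
      have h2 := h0.size_le.1
      have h3 := hB ⟨a, j, hj⟩
      have h4 := hU ⟨a, j, hj⟩
      refine ⟨_, .loopStep h0 (by simp) h3 ht, ?_⟩
      simp only at h1 h2 h4 ⊢
      have h5 : (j + 1 + 1) * (2 * T.eval (s a) + U.eval (s a)) =
        (j + 1) * (2 * T.eval (s a) + U.eval (s a)) + (2 * T.eval (s a) + U.eval (s a)) := by ring
      omega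
  choose t ht ht' using fun a => key a (m a) le_rfl
  refine ⟨.loop C B, t, PolyBdd.mono ?_ ht', ht⟩
  exact (hm.add (.const 1)).mul (((PolyBdd.const 2).mul ⟨T, fun _ => le_rfl⟩).add
    ⟨U, fun _ => le_rfl⟩)

section Nat

variable {x y z w : α → ℕ}

theorem nat_const (c : ℕ) (hf : PolyTime s e f) : PolyTime s e fun _ => .nat c := hf.const _

theorem nat_add (hx : PolyTime s e fun a => .nat (x a)) (hy : PolyTime s e fun a => .nat (y a)) :
    PolyTime s e fun a => .nat (x a + y a) := op .add (hx.pair hy)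

theorem nat_sub (hx : PolyTime s e fun a => .nat (x a)) (hy : PolyTime s e fun a => .nat (y a)) :
    PolyTime s e fun a => .nat (x a - y a) := op .sub (hx.pair hy)

theorem nat_mul (hx : PolyTime s e fun a => .nat (x a)) (hy : PolyTime s e fun a => .nat (y a)) :
    PolyTime s e fun a => .nat (x a * y a) := op .mul (hx.pair hy)

theorem nat_div (hx : PolyTime s e fun a => .nat (x a)) (hy : PolyTime s e fun a => .nat (y a)) :
    PolyTime s e fun a => .nat (x a / y a) := op .div (hx.pair hy)

theorem nat_mod (hx : PolyTime s e fun a => .nat (x a)) (hy : PolyTime s e fun a => .nat (y a)) :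
    PolyTime s e fun a => .nat (x a % y a) := by
  simp only [Nat.mod_eq_sub_mul_div]
  exact hx.nat_sub (hy.nat_mul (hx.nat_div hy))

theorem nat_ite_eq (hx : PolyTime s e fun a => .nat (x a)) (hy : PolyTime s e fun a => .nat (y a))
    (hz : PolyTime s e fun a => .nat (z a)) (hw : PolyTime s e fun a => .nat (w a)) :
    PolyTime s e fun a => .nat (if x a = y a then z a else w a) := by
  -- The two truncated differences add up to zero exactly when the numbers agree, so the branches
  -- appear swapped.
  convert ((hx.nat_sub hy).nat_add (hy.nat_sub hx)).ite_ne_zero hw hz using 2 with a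
  split_ifs <;> first | rfl | omega

theorem nat_ite_lt (hx : PolyTime s e fun a => .nat (x a)) (hy : PolyTime s e fun a => .nat (y a))
    (hz : PolyTime s e fun a => .nat (z a)) (hw : PolyTime s e fun a => .nat (w a)) :
    PolyTime s e fun a => .nat (if x a < y a then z a else w a) := by
  convert (hy.nat_sub hx).ite_ne_zero hz hw using 2 with a
  split_ifs <;> first | rfl | omega

/-- Repeated multiplication: the number of passes is the exponent itself, so its value and not only
its bit size has to be polynomially bounded. -/
theorem nat_pow (hx : PolyTime s e fun a => .nat (x a)) (hy : PolyTime s e fun a => .nat (y a))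
    (hb : PolyBdd s y) : PolyTime s e fun a => .nat (x a ^ y a) := by
  let st : α → ℕ → Data := fun a i => .pair (.nat i) (.pair (.nat (x a)) (.nat (x a ^ (y a - i))))
  have hst : PolyBdd (fun p : Σ a, Fin (y a + 1) => s p.1) fun p => (st p.1 p.2).size := by
    refine PolyBdd.mono (PolyBdd.comap (fun p : Σ a, Fin (y a + 1) => p.1)
      (((hb.add hx.size_output).add (hb.mul hx.size_output)).add (.const 5))) fun p => ?_
    have h1 := Nat.size_le_self p.2
    have h2 := Nat.size_pow_le (x p.1) (y p.1 - p.2)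
    have h3 := p.2.2
    have h4 : (y p.1 - p.2) * (x p.1).size ≤ y p.1 * ((x p.1).size + 1) :=
      Nat.mul_le_mul (by omega) (by omega)
    simp only [st, Data.size_nat, Data.size_pair]
    omega
  have hst' := PolyTime.refl hst
  have hs : PolyTime (fun p : Σ a, Fin (y a) => s p.1) (fun p => st p.1 (p.2 + 1))
      (fun p => st p.1 (p.2 + 1)) :=
    hst'.comap fun p : Σ a, Fin (y a) => (⟨p.1, p.2.succ⟩ : Σ a, Fin (y a + 1))
  have hl := loop hb st hst'.fst ?_
  · refine PolyTime.comp ?_ hl.snd.snd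
    simpa [st] using hy.pair (hx.pair (hx.nat_const 1))
  · refine PolyTime.pair ?_ (PolyTime.pair hs.snd.fst ?_)
    · simpa using hs.fst.nat_sub (hs.nat_const 1)
    · refine (hs.snd.fst.nat_mul hs.snd.snd).of_eq fun p => ?_
      rw [← pow_succ']
      have := p.2.2
      congr 2
      omega

end Nat

/-- A computation repeated for every position of a table is treated as a family over pairs of an
instance and a position, with time still measured by the instance alone. -/
theorem sigma_refl (hm : PolyBdd s m) (he : PolyBdd s fun a => (e a).size) :
    PolyTime (fun p : Σ a, Fin (m a) => s p.1) (fun p => .pair (e p.1) (.nat p.2))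
      (fun p => .pair (e p.1) (.nat p.2)) := by
  refine PolyTime.refl (PolyBdd.mono (PolyBdd.comap Sigma.fst ((he.add hm).add (.const 2)))
    fun p => ?_)
  have h1 := Nat.size_le_self p.2
  have h3 := p.2.2
  simp only [Data.size_nat, Data.size_pair]
  omega

theorem sigma_fst (hm : PolyBdd s m) (hf : PolyTime s e f) :
    PolyTime (fun p : Σ a, Fin (m a) => s p.1) (fun p => .pair (e p.1) (.nat p.2))
      (fun p => f p.1) :=
  (sigma_refl hm hf.size_input).fst.comp (hf.comap Sigma.fst)

theorem sigma_snd (hm : PolyBdd s m) (he : PolyBdd s fun a => (e a).size) :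
    PolyTime (fun p : Σ a, Fin (m a) => s p.1) (fun p => .pair (e p.1) (.nat p.2))
      (fun p => .nat p.2) :=
  (sigma_refl hm he).snd

/-- The list grows from its end, by pairing new entries in front, while the counter descends. The
state carries `e a` along so that each entry can be computed from it. -/
theorem ofFn (hm : PolyBdd s m) (hm' : PolyTime s e fun a => .nat (m a))
    {f : (a : α) → Fin (m a) → Data}
    (hf : PolyTime (fun p : Σ a, Fin (m a) => s p.1) (fun p => .pair (e p.1) (.nat p.2))
      (fun p => f p.1 p.2)) :
    PolyTime s e fun a => .list (List.ofFn (f a)) := by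
  let st : α → ℕ → Data := fun a i =>
    .pair (e a) (.pair (.nat i) (.list ((List.ofFn (f a)).drop i)))
  obtain ⟨T, hT⟩ := hf.size_output
  have hst : PolyBdd (fun p : Σ a, Fin (m a + 1) => s p.1) fun p => (st p.1 p.2).size := by
    refine PolyBdd.mono (PolyBdd.comap (fun p : Σ a, Fin (m a + 1) => p.1)
      (((hm'.size_input.add hm).add
        ((hm.mul ⟨T, fun _ => le_rfl⟩).add hm)).add (.const 5))) fun p => ?_
    have h1 := Nat.size_le_self p.2
    have h3 := p.2.2
    have h4 : (((List.ofFn (f p.1)).drop p.2).map Data.size).sum ≤ m p.1 * T.eval (s p.1) := by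
      refine (List.sum_le_card_nsmul _ (T.eval (s p.1)) ?_).trans ?_
      · intro x hx
        obtain ⟨u, hu, rfl⟩ := List.mem_map.1 hx
        obtain ⟨i, rfl⟩ := (List.mem_ofFn' _ _).1 (List.mem_of_mem_drop hu)
        exact hT ⟨p.1, i⟩
      · simp only [List.length_map, List.length_drop, List.length_ofFn, smul_eq_mul]
        exact Nat.mul_le_mul_right _ (Nat.sub_le _ _)
    simp only [st, Data.size_nat, Data.size_pair, Data.size_list, List.length_drop,
      List.length_ofFn]
    omega
  have hst' := PolyTime.refl hst
  have hs : PolyTime (fun p : Σ a, Fin (m a) => s p.1) (fun p => st p.1 (p.2 + 1))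
      (fun p => st p.1 (p.2 + 1)) :=
    hst'.comap fun p : Σ a, Fin (m a) => (⟨p.1, p.2.succ⟩ : Σ a, Fin (m a + 1))
  have hl := loop hm st hst'.snd.fst ?_
  · refine PolyTime.comp ?_ hl.snd.snd
    have hnil : ∀ a, (List.ofFn (f a)).drop (m a) = [] := fun a => by simp
    simp only [st, hnil]
    exact (refl hm'.size_input).pair (hm'.pair (hm'.nat_const 0))
  · have hi : PolyTime (fun p : Σ a, Fin (m a) => s p.1) (fun p => st p.1 (p.2 + 1))
        fun p => .nat p.2 := by
      simpa using hs.snd.fst.nat_sub (hs.nat_const 1)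
    refine hs.fst.pair (hi.pair ?_)
    refine (((hs.fst.pair hi).comp hf).pair hs.snd.snd).of_eq fun p => ?_
    rw [List.drop_eq_getElem_cons (i := p.2) (by simp)]
    simp [Data.list]

/-- Walk down the list with `snd`. Beyond its end, `fst` and `snd` of the leaf `0` are again the
leaf `0`, which is the default value. -/
theorem getD {L : α → List Data} {x : α → ℕ} (hL : PolyTime s e fun a => .list (L a))
    (hx : PolyTime s e fun a => .nat (x a)) (hb : PolyBdd s x) :
    PolyTime s e fun a => (L a).getD (x a) (.nat 0) := by
  let st : α → ℕ → Data := fun a i => .pair (.nat i) (.list ((L a).drop (x a - i)))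
  have hst : PolyBdd (fun p : Σ a, Fin (x a + 1) => s p.1) fun p => (st p.1 p.2).size := by
    refine PolyBdd.mono (PolyBdd.comap (fun p : Σ a, Fin (x a + 1) => p.1)
      ((hL.size_output.add hb).add (.const 2))) fun p => ?_
    have h1 := Nat.size_le_self p.2
    have h3 := p.2.2
    have h4 : ∀ (l : List Data) (j : ℕ), (Data.list (l.drop j)).size ≤ (Data.list l).size := by
      intro l j
      have : ((l.map Data.size).drop j).sum ≤ (l.map Data.size).sum :=
        (List.drop_sublist _ _).sum_le_sum (by simp)
      simp only [Data.size_list, List.map_drop, List.length_drop]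
      omega
    have h5 := h4 (L p.1) (x p.1 - p.2)
    simp only [st, Data.size_nat, Data.size_pair]
    omega
  have hst' := PolyTime.refl hst
  have hs : PolyTime (fun p : Σ a, Fin (x a) => s p.1) (fun p => st p.1 (p.2 + 1))
      (fun p => st p.1 (p.2 + 1)) :=
    hst'.comap fun p : Σ a, Fin (x a) => (⟨p.1, p.2.succ⟩ : Σ a, Fin (x a + 1))
  have hl := loop hb st hst'.fst ?_
  · have hr := op .fst (PolyTime.comp (by simpa [st] using hx.pair hL) hl.snd)
    refine hr.of_eq fun a => ?_
    have h1 : (L a).getD (x a) (.nat 0) = ((L a).drop (x a)).getD 0 (.nat 0) := by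
      simp [List.getD_eq_getElem?_getD]
    rw [h1, Nat.sub_zero]
    cases (L a).drop (x a) <;> simp [Data.list, Op.eval]
  · refine PolyTime.pair ?_ ?_
    · simpa using hs.fst.nat_sub (hs.nat_const 1)
    · refine (op .snd hs.snd).of_eq fun p => ?_
      have h3 := p.2.2
      have h4 : x p.1 - (p.2 : ℕ) = (x p.1 - (p.2 + 1)) + 1 := by omega
      rw [h4, ← List.drop_drop]
      cases (L p.1).drop (x p.1 - (p.2 + 1)) <;> simp [Data.list, Op.eval]

end PolyTime

/-! ### The bimatrix game and its computation

A strategy of the bimatrix game is either a strategy `(i, j)` of a player of the given game, or one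
of the two strategies of a gate. The gates `(i, s, l, ρ, σ, τ)` serve to multiply the probabilities
of the strategies `s l'` of the players `l' ≠ i`, one factor `l` after the other: the product of `t`
and `q` is `4 * ((t + q) / 4) ^ 2 - 4 * ((t - q) / 4) ^ 2`, where `σ` selects the square, and a
square is computed from the iterates `ρ` of `z ↦ |2 * z - 1|`, by
`z ^ 2 = z - 1 / 4 + |2 * z - 1| ^ 2 / 4`. Positive and negative parts are distinguished by `τ`. -/

/-- A `k`-player game with `n` strategies each and payoffs `num i s / den i s`, and a number `b` of
bits of accuracy. -/
structure GameInstance where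
  k : ℕ
  n : ℕ
  b : ℕ
  num : ℕ → ℕ → ℕ
  den : ℕ → ℕ → ℕ
  k_pos : 0 < k
  n_pos : 0 < n
  den_pos : ∀ i < k, ∀ s < n ^ k, 0 < den i s
  num_le : ∀ i < k, ∀ s < n ^ k, num i s ≤ den i s
  num_out : ∀ i s, ¬ (i < k ∧ s < n ^ k) → num i s = 0
  den_out : ∀ i s, ¬ (i < k ∧ s < n ^ k) → den i s = 0

/-- The coordinates of a strategy of the bimatrix game. For a player `gate` is `0`, and `s` is the
strategy. -/
structure StrategyIndex where
  gate : ℕ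
  i : ℕ
  s : ℕ
  l : ℕ
  ρ : ℕ
  σ : ℕ
  τ : ℕ
  bit : ℕ

/-- The indicator of equality. -/
def eqInd (a b : ℕ) : ℕ := if a = b then 1 else 0

namespace GameInstance

variable (I : GameInstance)

/-- The payoff table of the given game. -/
def table : List Data :=
  List.ofFn fun i : Fin I.k => .list (List.ofFn fun l : Fin (I.n ^ I.k) =>
    .pair (.nat (I.num i l)) (.nat (I.den i l)))

/-- The description of the given game. -/
def gameData : Data := .pair (.nat I.k) (.pair (.nat I.n) (.list I.table))

/-- The input. -/
def input : Data := .pair I.gameData (.nat I.b)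

/-- The size of the input. -/
def inputSize : ℕ := I.gameData.size + I.b

/-- The number of payoff entries. -/
def W : ℕ := I.k * I.n ^ I.k

/-- The number of payoff entries divided by the accuracy. -/
def H : ℕ := I.W * 2 ^ I.b

/-- The number of iterates for a square. -/
def R : ℕ := I.W + I.b + 4

/-- The number of blocks of strategies. -/
def K : ℕ := I.k + 4 * (I.k * I.n ^ I.k * I.k * I.R)

/-- The penalty for the mass of the own block. -/
def M : ℕ := 2 ^ 22 * I.H ^ 7

/-- The number of strategies of the bimatrix game. -/
def N : ℕ := I.k * I.n + I.k * I.n ^ I.k * I.k * I.R * 2 * 2 * 2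

/-- The coordinates of the strategy number `r`. -/
def decode (r : ℕ) : StrategyIndex where
  gate := if r < I.k * I.n then 0 else 1
  i := if r < I.k * I.n then r / I.n else (r - I.k * I.n) / 2 / 2 / 2 / I.R / I.k / I.n ^ I.k
  s := if r < I.k * I.n then r % I.n
    else (r - I.k * I.n) / 2 / 2 / 2 / I.R / I.k % I.n ^ I.k
  l := (r - I.k * I.n) / 2 / 2 / 2 / I.R % I.k
  ρ := (r - I.k * I.n) / 2 / 2 / 2 % I.R
  σ := (r - I.k * I.n) / 2 / 2 % 2
  τ := (r - I.k * I.n) / 2 % 2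
  bit := (r - I.k * I.n) % 2

variable (i s l : ℕ) (r c : StrategyIndex)

/-- Whether `c` contributes to the product of the first `l` factors. -/
def prodMatch : ℕ :=
  eqInd c.gate 1 * eqInd c.i i * eqInd c.s s * eqInd (c.l + 1) l * eqInd c.bit 1

/-- Positive part of the coefficients of the product of the first `l` factors, times `4 ^ R`. -/
def prodPos : ℕ :=
  eqInd l 0 * 4 ^ I.R + prodMatch i s l c * eqInd c.σ 0 * (I.K * 4 ^ (I.R + 1 - c.ρ))

/-- Negative part of the coefficients of the product of the first `l` factors, times `4 ^ R`. -/
def prodNeg : ℕ := prodMatch i s l c * eqInd c.σ 1 * (I.K * 4 ^ (I.R + 1 - c.ρ))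

/-- Coefficients of the factor number `l`, times `4 ^ R`. -/
def factor : ℕ :=
  if l = i then 4 ^ I.R
  else eqInd c.gate 0 * eqInd c.i l * eqInd c.s (s / I.n ^ l % I.n) * (I.K * 4 ^ I.R)

/-- Whether `r` and `c` belong to the same sequence of iterates. -/
def sameChain : ℕ :=
  eqInd c.gate 1 * eqInd c.i r.i * eqInd c.s r.s * eqInd c.l r.l * eqInd c.σ r.σ

/-- Positive part of the coefficients of the linear form of `r`, times `4 ^ (R + 1)`. -/
def formPos : ℕ :=
  if r.ρ = 0 then
    I.prodPos r.i r.s r.l c + (if r.σ = 0 then I.factor r.i r.s r.l c else 0)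
  else sameChain r c * eqInd (c.ρ + 1) r.ρ * eqInd c.bit 1 * (2 * I.K * 4 ^ (I.R + 1))

/-- Negative part of the coefficients of the linear form of `r`, times `4 ^ (R + 1)`. -/
def formNeg : ℕ :=
  if r.ρ = 0 then
    I.prodNeg r.i r.s r.l c + (if r.σ = 0 then 0 else I.factor r.i r.s r.l c)
  else 4 ^ (I.R + 1)

/-- Coefficients of the value of the gate of `r`, times `4 ^ (R + 1)`. -/
def selfCoef : ℕ :=
  sameChain r c * eqInd c.ρ r.ρ * eqInd c.τ r.τ * eqInd c.bit 1 * (I.K * 4 ^ (I.R + 1))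

/-- Whether `r` is the strategy of player `i` in the profile number `s` of the gate `c`. -/
def profileMatch : ℕ := eqInd c.i r.i * eqInd (c.s / I.n ^ r.i % I.n) r.s

/-- Positive part of the coefficients of the bonus of `r`, times `4 ^ (R + 1) * entryDen`. -/
def bonusPos : ℕ :=
  if r.gate = 0 then I.profileMatch r c * (4 * I.num c.i c.s * I.prodPos r.i c.s I.k c)
  else if r.bit = 0 then 0 else if r.τ = 0 then I.formPos r c else I.formNeg r c

/-- Negative part of the coefficients of the bonus of `r`, times `4 ^ (R + 1) * entryDen`. -/
def bonusNeg : ℕ :=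
  if r.gate = 0 then I.profileMatch r c * (4 * I.num c.i c.s * I.prodNeg r.i c.s I.k c)
  else if r.bit = 0 then 0
  else (if r.τ = 0 then I.formNeg r c else I.formPos r c) + I.selfCoef r c

/-- The denominator of the payoff in the given game that is used by `r` and `c`. -/
def entryDen : ℕ := if r.gate = 0 then if c.gate = 1 then I.den c.i c.s else 1 else 1

/-- Whether `r` and `c` belong to the same block. -/
def sameBlock : ℕ :=
  eqInd c.gate r.gate * eqInd c.i r.i * (if r.gate = 0 then 1 else
    eqInd c.s r.s * eqInd c.l r.l * eqInd c.ρ r.ρ * eqInd c.σ r.σ * eqInd c.τ r.τ)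

/-- Numerator of the payoff of the row player. -/
def payoffNum : ℕ :=
  2 * I.M * 4 ^ (I.R + 1) * I.entryDen r c + I.bonusPos r c -
    (I.bonusNeg r c + sameBlock r c * (I.M * 4 ^ (I.R + 1) * I.entryDen r c))

/-- Denominator of the payoff of the row player. -/
def payoffDen : ℕ := 4 * I.M * 4 ^ (I.R + 1) * I.entryDen r c

/-- The payoff table of the row player. -/
def rowTable : Data := .list (List.ofFn fun l : Fin (I.N ^ 2) =>
  .pair (.nat (I.payoffNum (I.decode (l % I.N)) (I.decode (l / I.N))))
    (.nat (I.payoffDen (I.decode (l % I.N)) (I.decode (l / I.N)))))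

/-- The payoff table of the column player, who imitates the row player. -/
def columnTable : Data := .list (List.ofFn fun l : Fin (I.N ^ 2) =>
  .pair (.nat (eqInd (l % I.N) (l / I.N))) (.nat 1))

/-- The description of the bimatrix game. -/
def bimatrixData : Data := .pair (.nat 2) (.pair (.nat I.N) (.list [I.rowTable, I.columnTable]))

/-- The accuracy in the bimatrix game. -/
def accuracyData : Data := .pair (.nat 1) (.nat (2 ^ 33 * I.H ^ 8))

/-- The description of the mapping. -/
def mappingData : Data := .list (List.ofFn fun i : Fin I.k => .pair (.nat 1)
  (.list (List.ofFn fun j : Fin I.n => .nat (j + I.n * i))))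

/-- The output. -/
def output : Data := .pair I.bimatrixData (.pair I.accuracyData I.mappingData)

end GameInstance

/-! ### The output is computable in polynomial time. -/

/-- The data of the instance `I a` are available in polynomial time. -/
structure Available {α : Type} (s : α → ℕ) (e : α → Data) (I : α → GameInstance) : Prop where
  k : PolyTime s e fun a => .nat (I a).k
  n : PolyTime s e fun a => .nat (I a).n
  b : PolyTime s e fun a => .nat (I a).b
  table : PolyTime s e fun a => .list (I a).table
  W_bdd : PolyBdd s fun a => (I a).W
  b_bdd : PolyBdd s fun a => (I a).b

theorem PolyTime.nat_eqInd {α : Type} {s : α → ℕ} {e : α → Data} {x y : α → ℕ}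
    (hx : PolyTime s e fun a => .nat (x a)) (hy : PolyTime s e fun a => .nat (y a)) :
    PolyTime s e fun a => .nat (eqInd (x a) (y a)) :=
  hx.nat_ite_eq hy (hx.nat_const 1) (hx.nat_const 0)

/-- The coordinates are available in polynomial time, and polynomially bounded. -/
structure StrategyIndex.Available {α : Type} (sz : α → ℕ) (e : α → Data)
    (r : α → StrategyIndex) : Prop where
  gate : PolyTime sz e fun a => .nat (r a).gate
  i : PolyTime sz e fun a => .nat (r a).i
  s : PolyTime sz e fun a => .nat (r a).s
  l : PolyTime sz e fun a => .nat (r a).l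
  ρ : PolyTime sz e fun a => .nat (r a).ρ
  σ : PolyTime sz e fun a => .nat (r a).σ
  τ : PolyTime sz e fun a => .nat (r a).τ
  bit : PolyTime sz e fun a => .nat (r a).bit
  i_bdd : PolyBdd sz fun a => (r a).i
  s_bdd : PolyBdd sz fun a => (r a).s
  l_bdd : PolyBdd sz fun a => (r a).l

namespace GameInstance

theorem k_le_W (I : GameInstance) : I.k ≤ I.W :=
  Nat.le_mul_of_pos_right _ (pow_pos I.n_pos _)

theorem n_le_W (I : GameInstance) : I.n ≤ I.W :=
  (Nat.le_self_pow I.k_pos.ne' _).trans (Nat.le_mul_of_pos_left _ I.k_pos)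

/-- The description spells out every entry. All counts in the construction are polynomial in `W` and
`b`, hence in the input size. -/
theorem W_le_inputSize (I : GameInstance) : I.W ≤ I.inputSize := by
  have h : I.W ≤ (I.table.map Data.size).sum := by
    refine le_trans ?_ (List.card_nsmul_le_sum _ (I.n ^ I.k) ?_)
    · simp [table, W]
    · intro x hx
      obtain ⟨u, hu, rfl⟩ := List.mem_map.1 hx
      obtain ⟨i, rfl⟩ := (List.mem_ofFn' _ _).1 hu
      simp only [Data.size_list, List.length_ofFn]
      omega
  simp only [inputSize, gameData, Data.size_pair, Data.size_list]
  omega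

theorem available : Available inputSize input fun I => I := by
  have hin : PolyTime inputSize input input := by
    refine PolyTime.refl (PolyBdd.mono (PolyBdd.self.add (.const 2)) fun I => ?_)
    have := Nat.size_le_self I.b
    simp only [inputSize, input, Data.size_pair, Data.size_nat]
    omega
  exact {
    k := hin.fst.fst
    n := hin.fst.snd.fst
    b := hin.snd
    table := hin.fst.snd.snd
    W_bdd := PolyBdd.self.mono W_le_inputSize
    b_bdd := PolyBdd.self.mono fun I => Nat.le_add_left _ _ }

end GameInstance

namespace Available

open PolyTime

variable {α : Type} {s : α → ℕ} {e : α → Data} {I : α → GameInstance}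
  {m : α → ℕ} {r c : α → StrategyIndex}

theorem sigma (hI : Available s e I) (hm : PolyBdd s m) :
    Available (fun p : Σ a, Fin (m a) => s p.1) (fun p => .pair (e p.1) (.nat p.2))
      fun p => I p.1 where
  k := sigma_fst hm hI.k
  n := sigma_fst hm hI.n
  b := sigma_fst hm hI.b
  table := sigma_fst hm hI.table
  W_bdd := hI.W_bdd.comap Sigma.fst
  b_bdd := hI.b_bdd.comap Sigma.fst

theorem const (hI : Available s e I) (x : ℕ) : PolyTime s e fun _ => .nat x := hI.k.nat_const x

theorem k_bdd (hI : Available s e I) : PolyBdd s fun a => (I a).k :=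
  hI.W_bdd.mono fun a => (I a).k_le_W

theorem n_bdd (hI : Available s e I) : PolyBdd s fun a => (I a).n :=
  hI.W_bdd.mono fun a => (I a).n_le_W

theorem n_pow_k (hI : Available s e I) : PolyTime s e fun a => .nat ((I a).n ^ (I a).k) :=
  hI.n.nat_pow hI.k hI.k_bdd

theorem W (hI : Available s e I) : PolyTime s e fun a => .nat (I a).W := hI.k.nat_mul hI.n_pow_k

theorem H (hI : Available s e I) : PolyTime s e fun a => .nat (I a).H :=
  hI.W.nat_mul ((hI.const 2).nat_pow hI.b hI.b_bdd)

theorem R (hI : Available s e I) : PolyTime s e fun a => .nat (I a).R :=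
  (hI.W.nat_add hI.b).nat_add (hI.const 4)

theorem R_bdd (hI : Available s e I) : PolyBdd s fun a => (I a).R :=
  (hI.W_bdd.add hI.b_bdd).add (.const 4)

theorem K (hI : Available s e I) : PolyTime s e fun a => .nat (I a).K :=
  hI.k.nat_add ((hI.const 4).nat_mul (((hI.k.nat_mul hI.n_pow_k).nat_mul hI.k).nat_mul hI.R))

theorem M (hI : Available s e I) : PolyTime s e fun a => .nat (I a).M :=
  (hI.const (2 ^ 22)).nat_mul (hI.H.nat_pow (hI.const 7) (.const 7))

theorem N (hI : Available s e I) : PolyTime s e fun a => .nat (I a).N :=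
  (hI.k.nat_mul hI.n).nat_add (((((((hI.k.nat_mul hI.n_pow_k).nat_mul hI.k).nat_mul hI.R).nat_mul
    (hI.const 2)).nat_mul (hI.const 2)).nat_mul (hI.const 2)))

theorem N_bdd (hI : Available s e I) : PolyBdd s fun a => (I a).N :=
  (hI.k_bdd.mul hI.n_bdd).add (((((hI.W_bdd.mul hI.k_bdd).mul hI.R_bdd).mul (.const 2)).mul
    (.const 2)).mul (.const 2))

theorem decode (hI : Available s e I) {x : α → ℕ} (hx : PolyTime s e fun a => .nat (x a))
    (hb : PolyBdd s x) : StrategyIndex.Available s e fun a => (I a).decode (x a) := by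
  have h2 := hI.const 2
  have hkn := hI.k.nat_mul hI.n
  have hg := ((hx.nat_sub hkn).nat_div h2).nat_div h2
  have hg' := ((hg.nat_div h2).nat_div hI.R).nat_div hI.k
  exact {
    gate := hx.nat_ite_lt hkn (hI.const 0) (hI.const 1)
    i := hx.nat_ite_lt hkn (hx.nat_div hI.n) (hg'.nat_div hI.n_pow_k)
    s := hx.nat_ite_lt hkn (hx.nat_mod hI.n) (hg'.nat_mod hI.n_pow_k)
    l := ((hg.nat_div h2).nat_div hI.R).nat_mod hI.k
    ρ := (hg.nat_div h2).nat_mod hI.R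
    σ := hg.nat_mod h2
    τ := ((hx.nat_sub hkn).nat_div h2).nat_mod h2
    bit := (hx.nat_sub hkn).nat_mod h2
    i_bdd := hb.div.ite hb.sub.div.div.div.div.div.div
    s_bdd := hb.mod.ite hb.sub.div.div.div.div.div.mod
    l_bdd := hb.sub.div.div.div.div.mod }

/-- No range conditions are needed: a look-up outside the table returns the leaf `0`, in accordance
with `num_out` and `den_out`. -/
theorem num_den (hI : Available s e I) {x y : α → ℕ} (hx : PolyTime s e fun a => .nat (x a))
    (hy : PolyTime s e fun a => .nat (y a)) (hxb : PolyBdd s x) (hyb : PolyBdd s y) :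
    PolyTime s e (fun a => .nat ((I a).num (x a) (y a))) ∧
      PolyTime s e (fun a => .nat ((I a).den (x a) (y a))) := by
  let L : α → List Data := fun a => if x a < (I a).k then
    List.ofFn fun l : Fin ((I a).n ^ (I a).k) =>
      .pair (.nat ((I a).num (x a) l)) (.nat ((I a).den (x a) l)) else []
  have hL : PolyTime s e fun a => .list (L a) := by
    refine (hI.table.getD hx hxb).of_eq fun a => ?_
    by_cases h : x a < (I a).k <;>
      simp [L, GameInstance.table, List.getD_eq_getElem?_getD, h, Data.list]
  have hg := hL.getD hy hyb
  have key : ∀ a, (L a).getD (y a) (.nat 0) = if x a < (I a).k ∧ y a < (I a).n ^ (I a).k then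
      .pair (.nat ((I a).num (x a) (y a))) (.nat ((I a).den (x a) (y a))) else .nat 0 := by
    intro a
    by_cases h : x a < (I a).k <;> by_cases h' : y a < (I a).n ^ (I a).k <;>
      simp [L, List.getD_eq_getElem?_getD, h, h']
  refine ⟨(op .fst hg).of_eq fun a => ?_, (op .snd hg).of_eq fun a => ?_⟩
  · rw [key]
    split_ifs with h
    · rfl
    · rw [(I a).num_out _ _ h]; rfl
  · rw [key]
    split_ifs with h
    · rfl
    · rw [(I a).den_out _ _ h]; rfl

section Coefficients

variable {x y z : α → ℕ}

theorem prodMatch (hI : Available s e I) (hc : StrategyIndex.Available s e c)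
    (hx : PolyTime s e fun a => .nat (x a)) (hy : PolyTime s e fun a => .nat (y a))
    (hz : PolyTime s e fun a => .nat (z a)) :
    PolyTime s e fun a => .nat (GameInstance.prodMatch (x a) (y a) (z a) (c a)) :=
  ((((hc.gate.nat_eqInd (hI.const 1)).nat_mul (hc.i.nat_eqInd hx)).nat_mul
    (hc.s.nat_eqInd hy)).nat_mul ((hc.l.nat_add (hI.const 1)).nat_eqInd hz)).nat_mul
      (hc.bit.nat_eqInd (hI.const 1))

theorem weight (hI : Available s e I) (hc : StrategyIndex.Available s e c) :
    PolyTime s e fun a => .nat ((I a).K * 4 ^ ((I a).R + 1 - (c a).ρ)) :=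
  hI.K.nat_mul ((hI.const 4).nat_pow ((hI.R.nat_add (hI.const 1)).nat_sub hc.ρ)
    (hI.R_bdd.add (.const 1)).sub)

theorem four_pow_R (hI : Available s e I) : PolyTime s e fun a => .nat (4 ^ (I a).R) :=
  (hI.const 4).nat_pow hI.R hI.R_bdd

theorem scale (hI : Available s e I) : PolyTime s e fun a => .nat (4 ^ ((I a).R + 1)) :=
  (hI.const 4).nat_pow (hI.R.nat_add (hI.const 1)) (hI.R_bdd.add (.const 1))

theorem prodPos (hI : Available s e I) (hc : StrategyIndex.Available s e c)
    (hx : PolyTime s e fun a => .nat (x a)) (hy : PolyTime s e fun a => .nat (y a))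
    (hz : PolyTime s e fun a => .nat (z a)) :
    PolyTime s e fun a => .nat ((I a).prodPos (x a) (y a) (z a) (c a)) :=
  ((hz.nat_eqInd (hI.const 0)).nat_mul hI.four_pow_R).nat_add
    (((hI.prodMatch hc hx hy hz).nat_mul (hc.σ.nat_eqInd (hI.const 0))).nat_mul (hI.weight hc))

theorem prodNeg (hI : Available s e I) (hc : StrategyIndex.Available s e c)
    (hx : PolyTime s e fun a => .nat (x a)) (hy : PolyTime s e fun a => .nat (y a))
    (hz : PolyTime s e fun a => .nat (z a)) :
    PolyTime s e fun a => .nat ((I a).prodNeg (x a) (y a) (z a) (c a)) :=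
  ((hI.prodMatch hc hx hy hz).nat_mul (hc.σ.nat_eqInd (hI.const 1))).nat_mul (hI.weight hc)

theorem digit (hI : Available s e I) (hx : PolyTime s e fun a => .nat (x a))
    (hy : PolyTime s e fun a => .nat (y a)) (hyb : PolyBdd s y) :
    PolyTime s e fun a => .nat (x a / (I a).n ^ y a % (I a).n) :=
  (hx.nat_div (hI.n.nat_pow hy hyb)).nat_mod hI.n

theorem factor (hI : Available s e I) (hr : StrategyIndex.Available s e r)
    (hc : StrategyIndex.Available s e c) :
    PolyTime s e fun a => .nat ((I a).factor (r a).i (r a).s (r a).l (c a)) :=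
  hr.l.nat_ite_eq hr.i hI.four_pow_R ((((hc.gate.nat_eqInd (hI.const 0)).nat_mul
    (hc.i.nat_eqInd hr.l)).nat_mul (hc.s.nat_eqInd (hI.digit hr.s hr.l hr.l_bdd))).nat_mul
      (hI.K.nat_mul hI.four_pow_R))

theorem sameChain (hI : Available s e I) (hr : StrategyIndex.Available s e r)
    (hc : StrategyIndex.Available s e c) :
    PolyTime s e fun a => .nat (GameInstance.sameChain (r a) (c a)) :=
  ((((hc.gate.nat_eqInd (hI.const 1)).nat_mul (hc.i.nat_eqInd hr.i)).nat_mul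
    (hc.s.nat_eqInd hr.s)).nat_mul (hc.l.nat_eqInd hr.l)).nat_mul (hc.σ.nat_eqInd hr.σ)

theorem formPos (hI : Available s e I) (hr : StrategyIndex.Available s e r)
    (hc : StrategyIndex.Available s e c) :
    PolyTime s e fun a => .nat ((I a).formPos (r a) (c a)) :=
  hr.ρ.nat_ite_eq (hI.const 0)
    ((hI.prodPos hc hr.i hr.s hr.l).nat_add
      (hr.σ.nat_ite_eq (hI.const 0) (hI.factor hr hc) (hI.const 0)))
    ((((hI.sameChain hr hc).nat_mul ((hc.ρ.nat_add (hI.const 1)).nat_eqInd hr.ρ)).nat_mul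
      (hc.bit.nat_eqInd (hI.const 1))).nat_mul (((hI.const 2).nat_mul hI.K).nat_mul hI.scale))

theorem formNeg (hI : Available s e I) (hr : StrategyIndex.Available s e r)
    (hc : StrategyIndex.Available s e c) :
    PolyTime s e fun a => .nat ((I a).formNeg (r a) (c a)) :=
  hr.ρ.nat_ite_eq (hI.const 0)
    ((hI.prodNeg hc hr.i hr.s hr.l).nat_add
      (hr.σ.nat_ite_eq (hI.const 0) (hI.const 0) (hI.factor hr hc))) hI.scale

theorem selfCoef (hI : Available s e I) (hr : StrategyIndex.Available s e r)
    (hc : StrategyIndex.Available s e c) :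
    PolyTime s e fun a => .nat ((I a).selfCoef (r a) (c a)) :=
  ((((hI.sameChain hr hc).nat_mul (hc.ρ.nat_eqInd hr.ρ)).nat_mul (hc.τ.nat_eqInd hr.τ)).nat_mul
    (hc.bit.nat_eqInd (hI.const 1))).nat_mul (hI.K.nat_mul hI.scale)

theorem profileMatch (hI : Available s e I) (hr : StrategyIndex.Available s e r)
    (hc : StrategyIndex.Available s e c) :
    PolyTime s e fun a => .nat ((I a).profileMatch (r a) (c a)) :=
  (hc.i.nat_eqInd hr.i).nat_mul ((hI.digit hc.s hr.i hr.i_bdd).nat_eqInd hr.s)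

theorem bonusPos (hI : Available s e I) (hr : StrategyIndex.Available s e r)
    (hc : StrategyIndex.Available s e c) :
    PolyTime s e fun a => .nat ((I a).bonusPos (r a) (c a)) :=
  hr.gate.nat_ite_eq (hI.const 0)
    ((hI.profileMatch hr hc).nat_mul (((hI.const 4).nat_mul
      (hI.num_den hc.i hc.s hc.i_bdd hc.s_bdd).1).nat_mul (hI.prodPos hc hr.i hc.s hI.k)))
    (hr.bit.nat_ite_eq (hI.const 0) (hI.const 0)
      (hr.τ.nat_ite_eq (hI.const 0) (hI.formPos hr hc) (hI.formNeg hr hc)))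

theorem bonusNeg (hI : Available s e I) (hr : StrategyIndex.Available s e r)
    (hc : StrategyIndex.Available s e c) :
    PolyTime s e fun a => .nat ((I a).bonusNeg (r a) (c a)) :=
  hr.gate.nat_ite_eq (hI.const 0)
    ((hI.profileMatch hr hc).nat_mul (((hI.const 4).nat_mul
      (hI.num_den hc.i hc.s hc.i_bdd hc.s_bdd).1).nat_mul (hI.prodNeg hc hr.i hc.s hI.k)))
    (hr.bit.nat_ite_eq (hI.const 0) (hI.const 0)
      ((hr.τ.nat_ite_eq (hI.const 0) (hI.formNeg hr hc) (hI.formPos hr hc)).nat_add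
        (hI.selfCoef hr hc)))

theorem entryDen (hI : Available s e I) (hr : StrategyIndex.Available s e r)
    (hc : StrategyIndex.Available s e c) :
    PolyTime s e fun a => .nat ((I a).entryDen (r a) (c a)) :=
  hr.gate.nat_ite_eq (hI.const 0) (hc.gate.nat_ite_eq (hI.const 1)
    (hI.num_den hc.i hc.s hc.i_bdd hc.s_bdd).2 (hI.const 1)) (hI.const 1)

theorem sameBlock (hI : Available s e I) (hr : StrategyIndex.Available s e r)
    (hc : StrategyIndex.Available s e c) :
    PolyTime s e fun a => .nat (GameInstance.sameBlock (r a) (c a)) :=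
  ((hc.gate.nat_eqInd hr.gate).nat_mul (hc.i.nat_eqInd hr.i)).nat_mul
    (hr.gate.nat_ite_eq (hI.const 0) (hI.const 1)
      (((((hc.s.nat_eqInd hr.s).nat_mul (hc.l.nat_eqInd hr.l)).nat_mul
        (hc.ρ.nat_eqInd hr.ρ)).nat_mul (hc.σ.nat_eqInd hr.σ)).nat_mul (hc.τ.nat_eqInd hr.τ)))

theorem payoffNum (hI : Available s e I) (hr : StrategyIndex.Available s e r)
    (hc : StrategyIndex.Available s e c) :
    PolyTime s e fun a => .nat ((I a).payoffNum (r a) (c a)) :=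
  (((((hI.const 2).nat_mul hI.M).nat_mul hI.scale).nat_mul (hI.entryDen hr hc)).nat_add
    (hI.bonusPos hr hc)).nat_sub ((hI.bonusNeg hr hc).nat_add ((hI.sameBlock hr hc).nat_mul
      ((hI.M.nat_mul hI.scale).nat_mul (hI.entryDen hr hc))))

theorem payoffDen (hI : Available s e I) (hr : StrategyIndex.Available s e r)
    (hc : StrategyIndex.Available s e c) :
    PolyTime s e fun a => .nat ((I a).payoffDen (r a) (c a)) :=
  (((hI.const 4).nat_mul hI.M).nat_mul hI.scale).nat_mul (hI.entryDen hr hc)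

end Coefficients

theorem N_sq_bdd (hI : Available s e I) : PolyBdd s fun a => (I a).N ^ 2 :=
  (hI.N_bdd.mul hI.N_bdd).mono fun _ => (sq _).le

theorem N_sq (hI : Available s e I) : PolyTime s e fun a => .nat ((I a).N ^ 2) :=
  hI.N.nat_pow (hI.const 2) (.const 2)

theorem rowTable (hI : Available s e I) : PolyTime s e fun a => (I a).rowTable := by
  have hb := hI.N_sq_bdd
  have hI' := hI.sigma hb
  have hl := sigma_snd hb hI.k.size_input
  have hlb : PolyBdd (fun p : Σ a, Fin ((I a).N ^ 2) => s p.1) fun p => (p.2 : ℕ) :=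
    PolyBdd.mono (hb.comap Sigma.fst) fun p => p.2.2.le
  -- The profile of row `r` and column `c` has index `r + N * c`.
  have hr := hI'.decode (hl.nat_mod hI'.N) hlb.mod
  have hc := hI'.decode (hl.nat_div hI'.N) hlb.div
  exact ofFn hb hI.N_sq ((hI'.payoffNum hr hc).pair (hI'.payoffDen hr hc))

theorem columnTable (hI : Available s e I) : PolyTime s e fun a => (I a).columnTable := by
  have hb := hI.N_sq_bdd
  have hI' := hI.sigma hb
  have hl := sigma_snd hb hI.k.size_input
  exact ofFn hb hI.N_sq (((hl.nat_mod hI'.N).nat_eqInd (hl.nat_div hI'.N)).pair (hI'.const 1))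

theorem mappingData (hI : Available s e I) : PolyTime s e fun a => (I a).mappingData := by
  have hI' := hI.sigma hI.k_bdd
  have hi := sigma_snd hI.k_bdd hI.k.size_input
  have hI'' := hI'.sigma hI'.n_bdd
  have hj := sigma_snd hI'.n_bdd hI'.k.size_input
  exact ofFn hI.k_bdd hI.k ((hI'.const 1).pair (ofFn hI'.n_bdd hI'.n
    (hj.nat_add (hI''.n.nat_mul (sigma_fst hI'.n_bdd hi)))))

theorem output (hI : Available s e I) : PolyTime s e fun a => (I a).output :=
  ((hI.const 2).pair (hI.N.pair (hI.rowTable.pair (hI.columnTable.pair (hI.const 0))))).pair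
    (((hI.const 1).pair ((hI.const (2 ^ 33)).nat_mul (hI.H.nat_pow (hI.const 8) (.const 8)))).pair
      hI.mappingData)

end Available

/-! ### Approximate arithmetic by truncated linear functions -/

/-- The projection to the unit interval. -/
noncomputable def unitClamp (x : ℝ) : ℝ := max 0 (min x 1)

/-- The truncated positive and negative parts of `f` add up to the truncated absolute value. This is
how a pair of gates computes `|f|`. -/
theorem abs_add_sub_min_abs_le {f x y δ : ℝ} (hx : |x - unitClamp f| ≤ δ)
    (hy : |y - unitClamp (-f)| ≤ δ) : |x + y - min 1 (|f|)| ≤ 2 * δ := by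
  have h : unitClamp f + unitClamp (-f) = min 1 |f| := by
    unfold unitClamp
    rcases le_total 0 f with h | h
    · rw [abs_of_nonneg h, max_eq_right (le_min h zero_le_one),
        max_eq_left ((min_le_left _ _).trans (by linarith)), add_zero, min_comm]
    · rw [abs_of_nonpos h, max_eq_left ((min_le_left _ _).trans h),
        max_eq_right (le_min (by linarith) zero_le_one), zero_add, min_comm]
  rw [← h, show x + y - (unitClamp f + unitClamp (-f)) =
    (x - unitClamp f) + (y - unitClamp (-f)) by ring, two_mul]
  exact (abs_add_le _ _).trans (add_le_add hx hy)

theorem abs_sq_sub_sq_le {a b d m : ℝ} (h : |a - b| ≤ d) (hm : |a + b| ≤ m) :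
    |a ^ 2 - b ^ 2| ≤ d * m := by
  rw [show a ^ 2 - b ^ 2 = (a - b) * (a + b) by ring, abs_mul]
  exact mul_le_mul h hm (abs_nonneg _) ((abs_nonneg _).trans h)

/-- The square as a series in the iterates of `z ↦ |2 * z - 1|`, with errors. -/
theorem abs_sum_iterates_sub_sq_le {δ : ℝ} (hδ : 0 ≤ δ) (hδ' : δ ≤ 1 / 6) (R : ℕ) :
    ∀ z : ℕ → ℝ, 0 ≤ z 0 → z 0 ≤ 1 + 2 * δ →
      (∀ ρ < R, 0 ≤ z (ρ + 1) ∧ |z (ρ + 1) - min 1 (|2 * z ρ - 1|)| ≤ 2 * δ) →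
      |∑ ρ ∈ Finset.range (R + 1), (z ρ - 1 / 4) / 4 ^ ρ - z 0 ^ 2| ≤
        6 * δ + 2 / 4 ^ (R + 1) := by
  induction R with
  | zero =>
    intro z h0 h1 _
    simp only [zero_add, Finset.range_one, Finset.sum_singleton, pow_zero, pow_one, div_one]
    -- For a single term the error is exactly `(z 0 - 1 / 2) ^ 2`.
    rw [abs_le]
    constructor <;> nlinarith
  | succ R ih =>
    intro z h0 h1 h
    obtain ⟨hz, hz'⟩ := h 0 (Nat.succ_pos _)
    rw [zero_add] at hz hz'
    have hz2 := abs_le.1 hz'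
    have hle : z 1 ≤ 1 + 2 * δ := by linarith [min_le_left 1 |2 * z 0 - 1|]
    have hrec := ih (fun ρ => z (ρ + 1)) hz hle fun ρ hρ => h (ρ + 1) (by omega)
    have habs : |2 * z 0 - 1| ≤ 1 + 4 * δ := abs_le.2 ⟨by linarith, by linarith⟩
    have hmin : |2 * z 0 - 1| - 4 * δ ≤ min 1 |2 * z 0 - 1| :=
      le_min (by linarith) (by linarith)
    -- Since `|2 * z 0 - 1|` may exceed `1` by `4 * δ`, the truncation costs that much on top of the
    -- error `2 * δ` of the iterate.
    have hd : |z 1 - (|2 * z 0 - 1|)| ≤ 6 * δ := by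
      rw [abs_le]
      constructor <;> linarith [min_le_right 1 |2 * z 0 - 1|]
    have hs := abs_sq_sub_sq_le hd (m := 3) (by
      rw [abs_of_nonneg (add_nonneg hz (abs_nonneg _))]; linarith)
    rw [sq_abs] at hs
    have e1 : ∑ ρ ∈ Finset.range (R + 1 + 1), (z ρ - 1 / 4) / 4 ^ ρ =
        z 0 - 1 / 4 + (∑ ρ ∈ Finset.range (R + 1), (z (ρ + 1) - 1 / 4) / 4 ^ ρ) / 4 := by
      rw [Finset.sum_range_succ', Finset.sum_div, add_comm]
      simp only [pow_zero, div_one, pow_succ, div_div]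
    have e2 : (2 : ℝ) / 4 ^ (R + 1 + 1) = 2 / 4 ^ (R + 1) / 4 := by
      rw [pow_succ _ (R + 1), div_div]
    rw [e1, e2]
    -- The bound reproduces itself: a quarter of `6 * δ` from the shifted series and a quarter of `6
    -- * δ * 3` from the first iterate make `6 * δ`.
    rw [abs_le] at hrec hs ⊢
    constructor <;> nlinarith

/-- The product as a difference of two squares, with errors. -/
theorem abs_sum_iterates_sub_mul_le {δ t q : ℝ} (hδ : 0 ≤ δ) (hδ' : δ ≤ 1 / 6) {R : ℕ}
    (hR : 0 < R) (ht : |t| ≤ 3 / 2) (hq0 : 0 ≤ q) (hq : q ≤ 7 / 6) (z w : ℕ → ℝ)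
    (hz0 : ∀ ρ < R, 0 ≤ z ρ) (hw0 : ∀ ρ < R, 0 ≤ w ρ)
    (hz : |z 0 - min 1 (|(t + q) / 4|)| ≤ 2 * δ) (hw : |w 0 - min 1 (|(t - q) / 4|)| ≤ 2 * δ)
    (hz' : ∀ ρ, ρ + 1 < R → |z (ρ + 1) - min 1 (|2 * z ρ - 1|)| ≤ 2 * δ)
    (hw' : ∀ ρ, ρ + 1 < R → |w (ρ + 1) - min 1 (|2 * w ρ - 1|)| ≤ 2 * δ) :
    |4 * ∑ ρ ∈ Finset.range R, (z ρ - w ρ) / 4 ^ ρ - t * q| ≤ 80 * δ + 16 / 4 ^ R := by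
  obtain ⟨R, rfl⟩ := Nat.exists_eq_succ_of_ne_zero hR.ne'
  simp only [Nat.succ_eq_add_one] at *
  have ht' := abs_le.1 ht
  -- The division by `4` in `(t ± q) / 4` keeps the arguments below `3 / 4`, where the truncation at
  -- `1` has no effect.
  have base : ∀ {a b : ℝ}, |b| ≤ 3 / 4 → |a - min 1 (|b|)| ≤ 2 * δ → 0 ≤ a →
      a ≤ 1 + 2 * δ ∧ |a ^ 2 - b ^ 2| ≤ 4 * δ := by
    intro a b hb ha ha0
    rw [min_eq_right (by linarith)] at ha
    have := abs_le.1 ha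
    have hs := abs_sq_sub_sq_le ha (m := 2) (by
      rw [abs_of_nonneg (add_nonneg ha0 (abs_nonneg _))]; linarith)
    rw [sq_abs] at hs
    exact ⟨by linarith, by linarith⟩
  obtain ⟨z1, z2⟩ := base (abs_le.2 ⟨by linarith, by linarith⟩) hz (hz0 0 hR)
  obtain ⟨w1, w2⟩ := base (abs_le.2 ⟨by linarith, by linarith⟩) hw (hw0 0 hR)
  have z3 := abs_sum_iterates_sub_sq_le hδ hδ' R z (hz0 0 hR) z1
    fun ρ hρ => ⟨hz0 _ (by omega), hz' ρ (by omega)⟩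
  have w3 := abs_sum_iterates_sub_sq_le hδ hδ' R w (hw0 0 hR) w1
    fun ρ hρ => ⟨hw0 _ (by omega), hw' ρ (by omega)⟩
  have e : ∑ ρ ∈ Finset.range (R + 1), (z ρ - w ρ) / 4 ^ ρ =
      ∑ ρ ∈ Finset.range (R + 1), (z ρ - 1 / 4) / 4 ^ ρ -
        ∑ ρ ∈ Finset.range (R + 1), (w ρ - 1 / 4) / 4 ^ ρ := by
    rw [← Finset.sum_sub_distrib]
    exact Finset.sum_congr rfl fun ρ _ => by ring
  rw [e]
  have e2 : (16 : ℝ) / 4 ^ (R + 1) = 8 * (2 / 4 ^ (R + 1)) := by ring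
  rw [e2]
  -- Each square has error `6 * δ` from the series and `4 * δ` from its first iterate. Two squares
  -- and the factor `4` make `80 * δ`.
  rw [abs_le] at z2 w2 z3 w3 ⊢
  constructor <;> nlinarith

/-! ### Well-supported strategies with a penalty for the mass of the own block -/

section Blocks

variable {S B : Type} [Fintype S] [Fintype B] [DecidableEq B] (blk : S → B) {y : S → ℝ}
  {C : S → S → ℝ} {m M ε : ℝ}

/-- The mass of a block. -/
def blockMass (y : S → ℝ) (v : B) : ℝ := ∑ c with blk c = v, y c

theorem sum_blockMass : ∑ v, blockMass blk y v = ∑ c, y c :=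
  Finset.sum_fiberwise _ _ _

theorem abs_sum_mul_le_of_abs_le (hy0 : ∀ c, 0 ≤ y c) (hy1 : ∑ c, y c = 1)
    (hC : ∀ r c, |C r c| ≤ m) (r : S) : |∑ c, C r c * y c| ≤ m :=
  calc |∑ c, C r c * y c| ≤ ∑ c, |C r c * y c| := Finset.abs_sum_le_sum_abs _ _
    _ ≤ ∑ c, m * y c := Finset.sum_le_sum fun c _ => by
      rw [abs_mul, abs_of_nonneg (hy0 c)]
      exact mul_le_mul_of_nonneg_right (hC r c) (hy0 c)
    _ = m := by rw [← Finset.mul_sum, hy1, mul_one]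

/-- All blocks have about the same mass. -/
theorem abs_card_mul_blockMass_sub_one_le (hblk : Function.Surjective blk) (hy0 : ∀ c, 0 ≤ y c)
    (hy1 : ∑ c, y c = 1) (hC : ∀ r c, |C r c| ≤ m) (hM : 0 < M) (hε : 0 ≤ ε)
    (hws : ∀ r, 0 < y r → ∀ r', ∑ c, C r' c * y c - M * blockMass blk y (blk r') ≤
      ∑ c, C r c * y c - M * blockMass blk y (blk r) + ε) (v : B) :
    |Fintype.card B * blockMass blk y v - 1| ≤ Fintype.card B * ((2 * m + ε) / M) := by
  have hsum := abs_sum_mul_le_of_abs_le hy0 hy1 hC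
  -- If `v` contains a played strategy, moving to `w` gains at most `ε`, while the bonuses differ by
  -- at most `2 * m`. If not, `v` has mass zero.
  have hpair : ∀ v w, blockMass blk y v - blockMass blk y w ≤ (2 * m + ε) / M := by
    intro v w
    rw [le_div_iff₀ hM]
    obtain ⟨r', rfl⟩ := hblk w
    have h' := abs_le.1 (hsum r')
    by_cases hv : ∃ r, blk r = v ∧ 0 < y r
    · obtain ⟨r, rfl, hr⟩ := hv
      have h := abs_le.1 (hsum r)
      linarith [hws r hr r']
    · push Not at hv
      have h0 : blockMass blk y v ≤ 0 := Finset.sum_nonpos fun c hc =>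
        hv c (Finset.mem_filter.1 hc).2
      have h1 : 0 ≤ blockMass blk y (blk r') := Finset.sum_nonneg fun c _ => hy0 c
      nlinarith [mul_nonneg hM.le h1, mul_nonneg hM.le (neg_nonneg.2 h0)]
  have htot := (sum_blockMass blk (y := y)).trans hy1
  have e : Fintype.card B * blockMass blk y v - 1 =
      ∑ w, (blockMass blk y v - blockMass blk y w) := by
    rw [Finset.sum_sub_distrib, htot, Finset.sum_const, Finset.card_univ, nsmul_eq_mul]
  have e' : (Fintype.card B : ℝ) * ((2 * m + ε) / M) = ∑ _w : B, (2 * m + ε) / M := by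
    rw [Finset.sum_const, Finset.card_univ, nsmul_eq_mul]
  rw [e, e', abs_le, ← Finset.sum_neg_distrib]
  exact ⟨Finset.sum_le_sum fun w _ => by linarith [hpair w v],
    Finset.sum_le_sum fun w _ => hpair v w⟩

end Blocks

/-- The value of a gate is about the truncation of its linear form `L`. -/
theorem abs_sub_unitClamp_le {x x' L ε δ : ℝ} (hx : 0 ≤ x) (hx' : 0 ≤ x') (hε : 0 ≤ ε)
    (hmass : |x' + x - 1| ≤ δ) (h1 : 0 < x → 0 ≤ L - x + ε) (h0 : 0 < x' → L - x ≤ ε) :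
    |x - unitClamp L| ≤ ε + δ := by
  have hm := abs_le.1 hmass
  have hδ : 0 ≤ δ := (abs_nonneg _).trans hmass
  have hc1 : unitClamp L ≤ 1 := max_le zero_le_one (min_le_right _ _)
  have hc0 : 0 ≤ unitClamp L := le_max_left _ _
  have hcL : min L 1 ≤ unitClamp L := le_max_right _ _
  rw [abs_le]
  constructor
  -- If the alternative is not played, `x` is within `δ` of `1`, the largest value of `unitClamp`.
  · rcases hx'.eq_or_lt with h | h
    · linarith
    · have := h0 h
      have : unitClamp L ≤ x + ε := max_le (by linarith) ((min_le_left _ _).trans (by linarith))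
      linarith
  · rcases hx.eq_or_lt with h | h
    · linarith
    · have := h1 h
      have : x - ε - δ ≤ min L 1 := le_min (by linarith) (by linarith)
      linarith

/-! ### Evaluation of the payoffs of the bimatrix game -/

namespace GameInstance

variable (I : GameInstance)

/-- Gates. -/
abbrev Gate : Type :=
  ((((Fin I.k × Fin (I.n ^ I.k)) × Fin I.k) × Fin I.R) × Fin 2) × Fin 2

/-- Strategies of the bimatrix game. -/
abbrev Strategy : Type := (Fin I.k × Fin I.n) ⊕ (I.Gate × Fin 2)

/-- Blocks of strategies. -/
abbrev Block : Type := Fin I.k ⊕ I.Gate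

variable {I}

/-- The coordinates of a strategy. -/
def index : I.Strategy → StrategyIndex
  | .inl (i, j) => ⟨0, i, j, 0, 0, 0, 0, 0⟩
  | .inr ((((((i, s), l), ρ), σ), τ), bit) => ⟨1, i, s, l, ρ, σ, τ, bit⟩

/-- The block of a strategy. -/
def block : I.Strategy → I.Block
  | .inl p => .inl p.1
  | .inr p => .inr p.1

/-- The numbering of the strategies. -/
def encode : I.Strategy ≃ Fin I.N :=
  (Equiv.sumCongr finProdFinEquiv
    ((Equiv.prodCongr ((Equiv.prodCongr ((Equiv.prodCongr ((Equiv.prodCongr ((Equiv.prodCongr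
      finProdFinEquiv (.refl _)).trans finProdFinEquiv) (.refl _)).trans finProdFinEquiv)
        (.refl _)).trans finProdFinEquiv) (.refl _)).trans finProdFinEquiv) (.refl _)).trans
          finProdFinEquiv)).trans finSumFinEquiv

theorem encode_inl (i : Fin I.k) (j : Fin I.n) :
    (encode (.inl (i, j)) : ℕ) = j + I.n * i := rfl

theorem encode_inr (i : Fin I.k) (s : Fin (I.n ^ I.k)) (l : Fin I.k) (ρ : Fin I.R)
    (σ τ bit : Fin 2) : (encode (.inr ((((((i, s), l), ρ), σ), τ), bit)) : ℕ) =
      I.k * I.n + (bit + 2 * (τ + 2 * (σ + 2 * (ρ + I.R * (l + I.k * (s + I.n ^ I.k * i)))))) :=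
  rfl

theorem add_mul_mod_of_lt {a m : ℕ} (b : ℕ) (h : a < m) : (a + m * b) % m = a := by
  rw [Nat.add_mul_mod_self_left, Nat.mod_eq_of_lt h]

theorem add_mul_div_of_lt {a m : ℕ} (b : ℕ) (h : a < m) : (a + m * b) / m = b := by
  rw [Nat.add_mul_div_left _ _ (by omega), Nat.div_eq_of_lt h, zero_add]

theorem decode_encode (r : I.Strategy) : I.decode (encode r) = index r := by
  rcases r with ⟨i, j⟩ | ⟨⟨⟨⟨⟨⟨i, s⟩, l⟩, ρ⟩, σ⟩, τ⟩, bit⟩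
  · have h : (j : ℕ) + I.n * i < I.k * I.n := (finProdFinEquiv (i, j)).2
    rw [encode_inl]
    simp [decode, index, h, Nat.sub_eq_zero_of_le h.le, Nat.mod_eq_of_lt j.2, add_mul_div_of_lt]
  · rw [encode_inr]
    simp only [decode, index, Nat.add_sub_cancel_left, add_mul_mod_of_lt _ bit.2,
      add_mul_div_of_lt _ bit.2, add_mul_mod_of_lt _ τ.2, add_mul_div_of_lt _ τ.2,
      add_mul_mod_of_lt _ σ.2, add_mul_div_of_lt _ σ.2, add_mul_mod_of_lt _ ρ.2,
      add_mul_div_of_lt _ ρ.2, add_mul_mod_of_lt _ l.2, add_mul_div_of_lt _ l.2,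
      add_mul_mod_of_lt _ s.2, add_mul_div_of_lt _ s.2]
    simp

theorem card_block : Fintype.card I.Block = I.K := by
  simp only [Fintype.card_sum, Fintype.card_prod, Fintype.card_fin, K]
  ring

theorem block_surjective : Function.Surjective (block (I := I)) := by
  rintro (i | v)
  · exact ⟨.inl (i, ⟨0, I.n_pos⟩), rfl⟩
  · exact ⟨.inr (v, 0), rfl⟩

theorem eqInd_le_one (a b : ℕ) : eqInd a b ≤ 1 := by unfold eqInd; split_ifs <;> simp

theorem sameBlock_index (r c : I.Strategy) :
    sameBlock (index r) (index c) = if block c = block r then 1 else 0 := by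
  rcases r with ⟨i, j⟩ | ⟨⟨⟨⟨⟨⟨i, s⟩, l⟩, ρ⟩, σ⟩, τ⟩, bit⟩ <;>
  rcases c with ⟨i', j'⟩ | ⟨⟨⟨⟨⟨⟨i', s'⟩, l'⟩, ρ'⟩, σ'⟩, τ'⟩, bit'⟩
  · simp [sameBlock, index, block, eqInd, Fin.val_inj]
  · simp [sameBlock, index, block, eqInd]
  · simp [sameBlock, index, block, eqInd]
  · simp only [sameBlock, index, block, Sum.inr.injEq, Prod.mk.injEq,
      ite_and, one_ne_zero, if_false, eqInd, if_true, one_mul, Fin.val_inj]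
    split_ifs <;> simp_all

/-! ### Positivity and bounds for the coefficients. -/

theorem K_pos : 0 < I.K := Nat.add_pos_left I.k_pos _

theorem W_pos : 0 < I.W := Nat.mul_pos I.k_pos (pow_pos I.n_pos _)

theorem H_pos : 0 < I.H := Nat.mul_pos W_pos (by positivity)

theorem M_pos : 0 < I.M := Nat.mul_pos (by norm_num) (pow_pos H_pos _)

theorem entryDen_pos (r c : I.Strategy) : 0 < I.entryDen (index r) (index c) := by
  rcases r with ⟨i, j⟩ | ⟨⟨⟨⟨⟨⟨i, s⟩, l⟩, ρ⟩, σ⟩, τ⟩, bit⟩ <;>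
  rcases c with ⟨i', j'⟩ | ⟨⟨⟨⟨⟨⟨i', s'⟩, l'⟩, ρ'⟩, σ'⟩, τ'⟩, bit'⟩ <;>
  simp only [entryDen, index, if_true, one_ne_zero, zero_ne_one, if_false, Nat.one_pos]
  exact I.den_pos _ i'.2 _ s'.2

theorem ind_mul_le {a b m : ℕ} (ha : a ≤ 1) (hb : b ≤ m) : a * b ≤ m :=
  (Nat.mul_le_mul ha hb).trans (one_mul m).le

theorem prodMatch_le_one (i s l : ℕ) (c : StrategyIndex) : prodMatch i s l c ≤ 1 := by
  have h := fun a b => eqInd_le_one a b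
  unfold prodMatch
  exact ind_mul_le (ind_mul_le (ind_mul_le (ind_mul_le (h _ _) (h _ _))
    (h _ _)) (h _ _)) (h _ _)

theorem sameChain_le_one (r c : StrategyIndex) : sameChain r c ≤ 1 := by
  have h := fun a b => eqInd_le_one a b
  unfold sameChain
  exact ind_mul_le (ind_mul_le (ind_mul_le (ind_mul_le (h _ _) (h _ _))
    (h _ _)) (h _ _)) (h _ _)

theorem weight_le (ρ : ℕ) : I.K * 4 ^ (I.R + 1 - ρ) ≤ I.K * 4 ^ (I.R + 1) :=
  Nat.mul_le_mul_left _ (Nat.pow_le_pow_right (by norm_num) (Nat.sub_le _ _))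

theorem prodNeg_le (i s l : ℕ) (c : StrategyIndex) :
    I.prodNeg i s l c ≤ I.K * 4 ^ (I.R + 1) :=
  ind_mul_le (ind_mul_le (prodMatch_le_one i s l c) (eqInd_le_one _ _)) (weight_le _)

theorem prodPos_le (i s l : ℕ) (c : StrategyIndex) :
    I.prodPos i s l c ≤ 4 ^ I.R + I.K * 4 ^ (I.R + 1) :=
  Nat.add_le_add (ind_mul_le (eqInd_le_one _ _) le_rfl)
    (ind_mul_le (ind_mul_le (prodMatch_le_one i s l c) (eqInd_le_one _ _)) (weight_le _))

theorem prodPos_le_of_ne {l : ℕ} (hl : l ≠ 0) (i s : ℕ) (c : StrategyIndex) :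
    I.prodPos i s l c ≤ I.K * 4 ^ (I.R + 1) := by
  have : eqInd l 0 = 0 := if_neg hl
  rw [prodPos, this, zero_mul, zero_add]
  exact ind_mul_le (ind_mul_le (prodMatch_le_one i s l c) (eqInd_le_one _ _)) (weight_le _)

theorem factor_le (i s l : ℕ) (c : StrategyIndex) : I.factor i s l c ≤ I.K * 4 ^ I.R := by
  unfold factor
  split_ifs
  · exact Nat.le_mul_of_pos_left _ K_pos
  · exact ind_mul_le (ind_mul_le (ind_mul_le (eqInd_le_one _ _) (eqInd_le_one _ _))
      (eqInd_le_one _ _)) le_rfl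

theorem four_pow_R_le : 4 ^ I.R ≤ I.K * 4 ^ I.R := Nat.le_mul_of_pos_left _ K_pos

theorem formPos_le (r c : StrategyIndex) : I.formPos r c ≤ 2 * I.K * 4 ^ (I.R + 1) := by
  unfold formPos
  split_ifs
  · have h1 := I.prodPos_le r.i r.s r.l c
    have h2 := I.factor_le r.i r.s r.l c
    have h3 := I.four_pow_R_le
    rw [pow_succ] at h1 ⊢
    nlinarith
  · have h1 := I.prodPos_le r.i r.s r.l c
    have h3 := I.four_pow_R_le
    rw [pow_succ] at h1 ⊢
    nlinarith
  · exact ind_mul_le (ind_mul_le (ind_mul_le (sameChain_le_one r c) (eqInd_le_one _ _))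
      (eqInd_le_one _ _)) le_rfl

theorem formNeg_le (r c : StrategyIndex) : I.formNeg r c ≤ 2 * I.K * 4 ^ (I.R + 1) := by
  have h1 := I.prodNeg_le r.i r.s r.l c
  have h2 := I.factor_le r.i r.s r.l c
  have h3 := I.four_pow_R_le
  unfold formNeg
  rw [pow_succ] at h1 ⊢
  split_ifs <;> nlinarith

theorem selfCoef_le (r c : StrategyIndex) : I.selfCoef r c ≤ I.K * 4 ^ (I.R + 1) :=
  ind_mul_le (ind_mul_le (ind_mul_le (ind_mul_le (sameChain_le_one r c)
    (eqInd_le_one _ _)) (eqInd_le_one _ _)) (eqInd_le_one _ _)) le_rfl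

/-- On gate columns `entryDen` absorbs the numerator of the payoff. On player columns it is `1`, so
there the coefficient `x` must vanish. -/
theorem profileMatch_mul_le {i : Fin I.k} {j : Fin I.n} (c : I.Strategy) {x : ℕ}
    (hx : x ≤ I.K * 4 ^ (I.R + 1)) (hx0 : (index c).gate = 0 → x = 0) :
    I.profileMatch (index (.inl (i, j))) (index c) *
      (4 * I.num (index c).i (index c).s * x) ≤
        4 * I.K * 4 ^ (I.R + 1) * I.entryDen (index (.inl (i, j))) (index c) := by
  refine ind_mul_le (ind_mul_le (eqInd_le_one _ _) (eqInd_le_one _ _)) ?_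
  rcases c with ⟨i', j'⟩ | ⟨⟨⟨⟨⟨⟨i', s'⟩, l'⟩, ρ'⟩, σ'⟩, τ'⟩, bit'⟩
  · rw [hx0 rfl]; simp
  · have h := I.num_le i' i'.2 s' s'.2
    simp only [entryDen, index, if_true]
    calc 4 * I.num i' s' * x ≤ 4 * I.den i' s' * (I.K * 4 ^ (I.R + 1)) :=
          Nat.mul_le_mul (by omega) hx
      _ = _ := by ring

theorem prodMatch_of_gate_eq_zero {c : StrategyIndex} (h : c.gate = 0) (i s l : ℕ) :
    prodMatch i s l c = 0 := by simp [prodMatch, eqInd, h]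

theorem bonusPos_le (r c : I.Strategy) : I.bonusPos (index r) (index c) ≤
    4 * I.K * 4 ^ (I.R + 1) * I.entryDen (index r) (index c) := by
  rcases r with ⟨i, j⟩ | r
  · exact profileMatch_mul_le c (prodPos_le_of_ne I.k_pos.ne' _ _ _) fun h => by
      simp [prodPos, prodMatch_of_gate_eq_zero h, eqInd, I.k_pos.ne']
  · have h : 2 * I.K * 4 ^ (I.R + 1) ≤
        4 * I.K * 4 ^ (I.R + 1) * I.entryDen (index (.inr r)) (index c) := by
      have := entryDen_pos (.inr r) c
      exact Nat.le_mul_of_pos_right _ this |>.trans' (Nat.mul_le_mul_right _ (by omega))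
    refine le_trans ?_ h
    unfold bonusPos
    rw [if_neg (by simp [index])]
    split_ifs
    · exact Nat.zero_le _
    · exact formPos_le _ _
    · exact formNeg_le _ _

theorem bonusNeg_le (r c : I.Strategy) : I.bonusNeg (index r) (index c) ≤
    4 * I.K * 4 ^ (I.R + 1) * I.entryDen (index r) (index c) := by
  rcases r with ⟨i, j⟩ | r
  · exact profileMatch_mul_le c (prodNeg_le _ _ _ _) fun h => by
      simp [prodNeg, prodMatch_of_gate_eq_zero h]
  · have h : 3 * I.K * 4 ^ (I.R + 1) ≤
        4 * I.K * 4 ^ (I.R + 1) * I.entryDen (index (.inr r)) (index c) := by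
      have := entryDen_pos (.inr r) c
      exact Nat.le_mul_of_pos_right _ this |>.trans' (Nat.mul_le_mul_right _ (by omega))
    refine le_trans ?_ h
    have h1 := I.formPos_le (index (.inr r)) (index c)
    have h2 := I.formNeg_le (index (.inr r)) (index c)
    have h3 := I.selfCoef_le (index (.inr r)) (index c)
    unfold bonusNeg
    rw [if_neg (by simp [index])]
    split_ifs
    · exact Nat.zero_le _
    · nlinarith
    · nlinarith

/-- The coefficients of the part of the payoff that does not depend on the mass of the own block,
up to scaling. -/
noncomputable def bonus (r c : I.Strategy) : ℝ :=
  ((I.bonusPos (index r) (index c) : ℝ) - I.bonusNeg (index r) (index c)) /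
    (4 ^ (I.R + 1) * I.entryDen (index r) (index c))

theorem abs_bonus_le (r c : I.Strategy) : |bonus r c| ≤ 4 * I.K := by
  have hd : (0 : ℝ) < I.entryDen (index r) (index c) := by exact_mod_cast entryDen_pos r c
  have hd' : (0 : ℝ) < 4 ^ (I.R + 1) * I.entryDen (index r) (index c) := by positivity
  have h1 : (I.bonusPos (index r) (index c) : ℝ) ≤
    4 * I.K * 4 ^ (I.R + 1) * I.entryDen (index r) (index c) := by exact_mod_cast bonusPos_le r c
  have h2 : (I.bonusNeg (index r) (index c) : ℝ) ≤
    4 * I.K * 4 ^ (I.R + 1) * I.entryDen (index r) (index c) := by exact_mod_cast bonusNeg_le r c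
  have h3 : (0 : ℝ) ≤ I.bonusPos (index r) (index c) := Nat.cast_nonneg _
  have h4 : (0 : ℝ) ≤ I.bonusNeg (index r) (index c) := Nat.cast_nonneg _
  rw [bonus, abs_div, abs_of_pos hd', div_le_iff₀ hd', abs_le]
  constructor <;> nlinarith

/-! ### Sizes of the construction in terms of `H`. -/

theorem R_le : I.R ≤ 5 * I.H := by
  have hb : I.b < 2 ^ I.b := Nat.lt_two_pow_self
  have hW := I.W_pos
  have : I.W + 2 ^ I.b ≤ I.W * 2 ^ I.b + 1 := by nlinarith [Nat.one_le_two_pow (n := I.b)]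
  have hH := I.H_pos
  unfold R
  unfold H at hH ⊢
  omega

theorem W_le_H : I.W ≤ I.H := Nat.le_mul_of_pos_right _ (by positivity)

theorem gates_le : I.k * I.n ^ I.k * I.k * I.R ≤ 5 * I.H ^ 3 :=
  calc I.k * I.n ^ I.k * I.k * I.R ≤ I.H * I.H * (5 * I.H) :=
        Nat.mul_le_mul (Nat.mul_le_mul W_le_H (I.k_le_W.trans W_le_H)) R_le
    _ = 5 * I.H ^ 3 := by ring

theorem H_le_cube : I.H ≤ I.H ^ 3 := Nat.le_self_pow (by norm_num) _

theorem K_le : I.K ≤ 25 * I.H ^ 3 := by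
  have h1 := I.gates_le
  have h2 := I.k_le_W.trans W_le_H
  have h3 := I.H_le_cube
  have h4 : 0 < I.H ^ 3 := pow_pos H_pos _
  unfold K
  omega

theorem N_le : I.N ≤ 41 * I.H ^ 3 := by
  have h1 := I.gates_le
  have h2 : I.k * I.n ≤ I.W := Nat.mul_le_mul_left _ (Nat.le_self_pow I.k_pos.ne' _)
  have h3 := I.H_le_cube
  have h4 := I.W_le_H
  unfold N
  omega

/-- The penalty dominates the bonuses, so the truncated subtraction in `payoffNum` never truncates
and the payoffs stay in `[0, 1]`. -/
theorem four_mul_K_le_M : 4 * I.K ≤ I.M := by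
  have h1 := I.K_le
  have h2 : I.H ^ 3 ≤ I.H ^ 7 := Nat.pow_le_pow_right H_pos (by norm_num)
  unfold M
  omega

theorem payoffNum_eq (r c : I.Strategy) : (I.payoffNum (index r) (index c) : ℝ) =
    4 ^ (I.R + 1) * I.entryDen (index r) (index c) *
      (2 * I.M + bonus r c - (if block c = block r then (I.M : ℝ) else 0)) := by
  have hd : (0 : ℝ) < I.entryDen (index r) (index c) := by exact_mod_cast entryDen_pos r c
  have h1 := bonusNeg_le r c
  have h2 : 4 * I.K * 4 ^ (I.R + 1) * I.entryDen (index r) (index c) ≤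
      I.M * 4 ^ (I.R + 1) * I.entryDen (index r) (index c) :=
    Nat.mul_le_mul_right _ (Nat.mul_le_mul_right _ four_mul_K_le_M)
  have h3 : sameBlock (index r) (index c) * (I.M * 4 ^ (I.R + 1) *
      I.entryDen (index r) (index c)) ≤ I.M * 4 ^ (I.R + 1) * I.entryDen (index r) (index c) :=
    ind_mul_le (by rw [sameBlock_index]; split_ifs <;> simp) le_rfl
  have h4 : 2 * I.M * 4 ^ (I.R + 1) * I.entryDen (index r) (index c) =
    2 * (I.M * 4 ^ (I.R + 1) * I.entryDen (index r) (index c)) := by ring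
  rw [payoffNum, Nat.cast_sub (by omega), sameBlock_index, bonus]
  push_cast
  field_simp
  split_ifs <;> ring

theorem payoffDen_pos (r c : I.Strategy) : 0 < I.payoffDen (index r) (index c) :=
  Nat.mul_pos (Nat.mul_pos (Nat.mul_pos (by norm_num) M_pos) (by positivity)) (entryDen_pos r c)

/-- The payoff of the row player, in terms of the bonus and the blocks. -/
theorem payoff_eq (r c : I.Strategy) :
    (I.payoffNum (index r) (index c) : ℝ) / I.payoffDen (index r) (index c) =
      (2 * I.M + bonus r c - (if block c = block r then (I.M : ℝ) else 0)) / (4 * I.M) := by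
  have hd : (0 : ℝ) < I.entryDen (index r) (index c) := by exact_mod_cast entryDen_pos r c
  have hM : (0 : ℝ) < I.M := by exact_mod_cast I.M_pos
  rw [payoffNum_eq, payoffDen]
  push_cast
  rw [show (4 : ℝ) * I.M * 4 ^ (I.R + 1) * I.entryDen (index r) (index c) =
    4 ^ (I.R + 1) * I.entryDen (index r) (index c) * (4 * I.M) by ring,
    mul_div_mul_left _ _ (by positivity)]

theorem payoffNum_le (r c : I.Strategy) :
    I.payoffNum (index r) (index c) ≤ I.payoffDen (index r) (index c) := by
  have h1 := bonusPos_le r c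
  have h2 : 4 * I.K * 4 ^ (I.R + 1) * I.entryDen (index r) (index c) ≤
      I.M * 4 ^ (I.R + 1) * I.entryDen (index r) (index c) :=
    Nat.mul_le_mul_right _ (Nat.mul_le_mul_right _ four_mul_K_le_M)
  refine (Nat.sub_le _ _).trans ?_
  rw [payoffDen]
  nlinarith

end GameInstance

/-! ### Expected bonuses in terms of the values of the gates. -/

namespace GameInstance

variable {I : GameInstance} {y : I.Strategy → ℝ}

/-- The value in `[0, 1]` that is represented by a gate. -/
noncomputable def gateValue (y : I.Strategy → ℝ) (i : Fin I.k) (s : Fin (I.n ^ I.k)) (l : Fin I.k)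
    (σ τ : Fin 2) (ρ : ℕ) : ℝ :=
  if h : ρ < I.R then I.K * y (.inr ((((((i, s), l), ⟨ρ, h⟩), σ), τ), 1)) else 0

/-- The iterates of `z ↦ |2 * z - 1|` that are represented by the gates. -/
noncomputable def iterateValue (y : I.Strategy → ℝ) (i : Fin I.k) (s : Fin (I.n ^ I.k))
    (l : Fin I.k) (σ : Fin 2) (ρ : ℕ) : ℝ :=
  gateValue y i s l σ 0 ρ + gateValue y i s l σ 1 ρ

/-- The products that are represented by the gates. -/
noncomputable def productValue (y : I.Strategy → ℝ) (i : Fin I.k) (s : Fin (I.n ^ I.k)) : ℕ → ℝ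
  | 0 => 1
  | l + 1 => if h : l < I.k then
      4 * ∑ ρ ∈ Finset.range I.R,
        (iterateValue y i s ⟨l, h⟩ 0 ρ - iterateValue y i s ⟨l, h⟩ 1 ρ) / 4 ^ ρ
    else 0

/-- The strategy of player `l` in the profile number `s`. -/
def digit (s : Fin (I.n ^ I.k)) (l : Fin I.k) : Fin I.n := finFunctionFinEquiv.symm s l

theorem digit_val (s : Fin (I.n ^ I.k)) (l : Fin I.k) :
    (digit s l : ℕ) = s / I.n ^ (l : ℕ) % I.n := rfl

/-- The factors that are represented by the players. -/
noncomputable def factorValue (y : I.Strategy → ℝ) (i : Fin I.k) (s : Fin (I.n ^ I.k))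
    (l : Fin I.k) : ℝ :=
  if l = i then 1 else I.K * y (.inl (l, digit s l))

theorem sum_eq_of_support (f : I.Strategy → ℝ) (i : Fin I.k) (s : Fin (I.n ^ I.k)) (l : Fin I.k)
    (h0 : ∀ p, f (.inl p) = 0)
    (h : ∀ i' s' l' ρ σ τ bit, ¬ (i' = i ∧ s' = s ∧ l' = l) →
      f (.inr ((((((i', s'), l'), ρ), σ), τ), bit)) = 0) :
    ∑ c, f c = ∑ ρ, ∑ σ, ∑ τ, ∑ bit, f (.inr ((((((i, s), l), ρ), σ), τ), bit)) := by
  rw [Fintype.sum_sum_type, Finset.sum_eq_zero fun p _ => h0 p, zero_add]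
  simp only [Fintype.sum_prod_type]
  rw [Fintype.sum_eq_single i, Fintype.sum_eq_single s, Fintype.sum_eq_single l]
  · intro l' hl'
    simp [h, hl']
  · intro s' hs'
    simp [h, hs']
  · intro i' hi'
    simp [h, hi']

/-- Because `y` has total mass one, a coefficient common to all columns contributes a constant. This
encodes the empty product; a longer product is read off the gates of its last factor. -/
theorem sum_prod (hy1 : ∑ c, y c = 1) (i : Fin I.k) (s : Fin (I.n ^ I.k)) {l : ℕ} (hl : l ≤ I.k) :
    ∑ c, ((I.prodPos i s l (index c) : ℝ) - I.prodNeg i s l (index c)) * y c =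
      4 ^ I.R * productValue y i s l := by
  rcases l with _ | l
  · simp [prodPos, prodNeg, prodMatch, eqInd, productValue, ← Finset.mul_sum, hy1]
  · have hlk : l < I.k := hl
    rw [sum_eq_of_support _ i s ⟨l, hlk⟩]
    · simp only [productValue, hlk, dif_pos, Finset.mul_sum, Finset.sum_range]
      refine Finset.sum_congr rfl fun ρ _ => ?_
      -- The additional factor `4` is the one in front of the difference of squares.
      have hw : (4 : ℝ) ^ (I.R + 1 - (ρ : ℕ)) = 4 ^ I.R * 4 / 4 ^ (ρ : ℕ) := by
        rw [pow_sub₀ _ (by norm_num) (by omega), pow_succ, div_eq_mul_inv]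
      simp [prodPos, prodNeg, prodMatch, eqInd, index, Fin.sum_univ_two, iterateValue, gateValue,
        hw]
      ring
    · rintro ⟨i', j'⟩
      simp [prodPos, prodNeg, prodMatch, eqInd, index]
    · intro i' s' l' ρ σ τ bit h
      have h' : prodMatch i s (l + 1) (index (I := I) (.inr ((((((i', s'), l'), ρ), σ), τ), bit))) =
          0 := by
        simp only [prodMatch, index, eqInd, Fin.val_inj, Nat.add_right_cancel_iff]
        by_contra hne
        apply h
        simp only [mul_eq_zero, not_or, ite_eq_right_iff, one_ne_zero, imp_false, not_not] at hne
        exact ⟨hne.1.1.1.2, hne.1.1.2, Fin.ext hne.1.2⟩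
      simp [prodPos, prodNeg, h', eqInd]

theorem sum_factor (hy1 : ∑ c, y c = 1) (i : Fin I.k) (s : Fin (I.n ^ I.k)) (l : Fin I.k) :
    ∑ c, (I.factor i s l (index c) : ℝ) * y c = 4 ^ I.R * factorValue y i s l := by
  unfold factor factorValue
  by_cases h : l = i
  · simp [h, ← Finset.mul_sum, hy1]
  · have h' : ¬ (l : ℕ) = i := fun h' => h (Fin.ext h')
    simp only [h, h', if_false]
    rw [Fintype.sum_eq_single (.inl (l, digit s l))]
    · simp [index, eqInd, digit_val]
      ring
    · rintro (⟨i', j'⟩ | ⟨⟨⟨⟨⟨⟨i', s'⟩, l'⟩, ρ'⟩, σ'⟩, τ'⟩, bit'⟩) hne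
      · simp only [index, eqInd, ← digit_val, Fin.val_inj]
        by_cases h1 : i' = l <;> by_cases h2 : j' = digit s l <;> simp_all
      · simp [index, eqInd]

/-- The linear form that is represented by a pair of gates. -/
noncomputable def formValue (y : I.Strategy → ℝ) (i : Fin I.k) (s : Fin (I.n ^ I.k)) (l : Fin I.k)
    (σ : Fin 2) : ℕ → ℝ
  | 0 => (productValue y i s l + (if σ = 0 then 1 else -1) * factorValue y i s l) / 4
  | ρ + 1 => 2 * iterateValue y i s l σ ρ - 1

theorem sameChain_eq_zero {i i' : Fin I.k} {s s' : Fin (I.n ^ I.k)} {l l' : Fin I.k}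
    {ρ ρ' : Fin I.R} {σ σ' τ τ' bit bit' : Fin 2} (h : ¬ (i' = i ∧ s' = s ∧ l' = l)) :
    sameChain (index (I := I) (.inr ((((((i, s), l), ρ), σ), τ), bit)))
      (index (I := I) (.inr ((((((i', s'), l'), ρ'), σ'), τ'), bit'))) = 0 := by
  simp only [sameChain, index, eqInd, Fin.val_inj]
  by_contra hne
  apply h
  simp only [mul_eq_zero, not_or, ite_eq_right_iff, one_ne_zero, imp_false, not_not] at hne
  exact ⟨hne.1.1.1.2, hne.1.1.2, hne.1.2⟩

theorem sum_form (hy1 : ∑ c, y c = 1) (i : Fin I.k) (s : Fin (I.n ^ I.k)) (l : Fin I.k)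
    (ρ : Fin I.R) (σ τ bit : Fin 2) :
    ∑ c, ((I.formPos (index (.inr ((((((i, s), l), ρ), σ), τ), bit))) (index c) : ℝ) -
      I.formNeg (index (.inr ((((((i, s), l), ρ), σ), τ), bit))) (index c)) * y c =
      4 ^ (I.R + 1) * formValue y i s l σ ρ := by
  obtain ⟨ρ, hρ⟩ := ρ
  rcases ρ with _ | ρ
  · have h1 := sum_prod hy1 i s l.2.le
    have h2 := sum_factor hy1 i s l
    -- The forms are scaled by `4 ^ (R + 1)` but products and factors by `4 ^ R`, which yields the
    -- division by `4`.
    have h3 : (4 : ℝ) ^ (I.R + 1) * formValue y i s l σ 0 =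
        4 ^ I.R * productValue y i s l +
          (if σ = 0 then 1 else -1) * (4 ^ I.R * factorValue y i s l) := by
      rw [formValue, pow_succ]; ring
    simp only [h3]
    rw [← h1, ← h2, Finset.mul_sum, ← Finset.sum_add_distrib]
    refine Finset.sum_congr rfl fun c _ => ?_
    by_cases hσ : σ = 0
    · simp [formPos, formNeg, index, hσ]
      ring
    · obtain rfl : σ = 1 := by omega
      simp [formPos, formNeg, index]
      ring
  · have h1 : ∑ c, (I.formPos (index (.inr ((((((i, s), l), ⟨ρ + 1, hρ⟩), σ), τ), bit)))
        (index c) : ℝ) * y c = 4 ^ (I.R + 1) * (2 * iterateValue y i s l σ ρ) := by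
      rw [sum_eq_of_support _ i s l]
      · rw [Fintype.sum_eq_single ⟨ρ, by omega⟩, Fintype.sum_eq_single σ]
        · have hρ' : ρ < I.R := by omega
          simp [formPos, sameChain, index, eqInd, Fin.sum_univ_two, iterateValue, gateValue, hρ']
          ring
        · intro σ' hσ'
          simp [formPos, sameChain, index, eqInd, Fin.val_inj, hσ']
        · intro ρ' hρ'
          have : ¬ (ρ' : ℕ) = ρ := fun h => hρ' (Fin.ext h)
          simp [formPos, sameChain, index, eqInd, this]
      · rintro ⟨i', j'⟩
        simp [formPos, sameChain, index, eqInd]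
      · intro i' s' l' ρ' σ' τ' bit' h
        unfold formPos
        rw [sameChain_eq_zero h]
        simp [index]
    have h2 : ∑ c, (I.formNeg (index (.inr ((((((i, s), l), ⟨ρ + 1, hρ⟩), σ), τ), bit)))
        (index c) : ℝ) * y c = 4 ^ (I.R + 1) := by
      simp [formNeg, index, ← Finset.mul_sum, hy1]
    simp only [sub_mul, Finset.sum_sub_distrib, h1, h2, formValue]
    ring

theorem sum_self (i : Fin I.k) (s : Fin (I.n ^ I.k)) (l : Fin I.k) (ρ : Fin I.R)
    (σ τ bit : Fin 2) :
    ∑ c, (I.selfCoef (index (.inr ((((((i, s), l), ρ), σ), τ), bit))) (index c) : ℝ) * y c =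
      4 ^ (I.R + 1) * gateValue y i s l σ τ ρ := by
  rw [Fintype.sum_eq_single (.inr ((((((i, s), l), ρ), σ), τ), 1))]
  · simp [selfCoef, sameChain, index, eqInd, gateValue]
    ring
  · rintro (⟨i', j'⟩ | ⟨⟨⟨⟨⟨⟨i', s'⟩, l'⟩, ρ'⟩, σ'⟩, τ'⟩, bit'⟩) hne
    · simp [selfCoef, sameChain, index, eqInd]
    · have h : I.selfCoef (index (.inr ((((((i, s), l), ρ), σ), τ), bit)))
          (index (.inr ((((((i', s'), l'), ρ'), σ'), τ'), bit'))) = 0 := by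
        by_contra h0
        apply hne
        simp only [selfCoef, sameChain, index, eqInd, mul_eq_zero, not_or, ite_eq_right_iff,
          one_ne_zero, imp_false, not_not, Fin.val_inj] at h0
        obtain ⟨⟨⟨⟨⟨⟨⟨⟨-, rfl⟩, rfl⟩, rfl⟩, rfl⟩, rfl⟩, rfl⟩, hb⟩, -⟩ := h0
        obtain rfl : bit' = 1 := by
          by_contra hc
          exact hb (if_neg fun h => hc (Fin.ext h))
        rfl
      simp [h]

theorem sum_bonus_gate_zero (v : I.Gate) : ∑ c, bonus (.inr (v, 0)) c * y c = 0 := by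
  obtain ⟨⟨⟨⟨⟨i, s⟩, l⟩, ρ⟩, σ⟩, τ⟩ := v
  simp [bonus, bonusPos, bonusNeg, index]

/-- The feedback term makes the second strategy of a gate attractive exactly while the value of the
gate is below its signed form. -/
theorem sum_bonus_gate_one (hy1 : ∑ c, y c = 1) (i : Fin I.k) (s : Fin (I.n ^ I.k)) (l : Fin I.k)
    (ρ : Fin I.R) (σ τ : Fin 2) :
    ∑ c, bonus (.inr ((((((i, s), l), ρ), σ), τ), 1)) c * y c =
      (if τ = 0 then 1 else -1) * formValue y i s l σ ρ - gateValue y i s l σ τ ρ := by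
  have h1 := sum_form hy1 i s l ρ σ τ 1
  have h2 := sum_self (y := y) i s l ρ σ τ 1
  have hp : (0 : ℝ) < 4 ^ (I.R + 1) := by positivity
  rw [← mul_right_inj' hp.ne', mul_sub, mul_left_comm, ← h1, ← h2, Finset.mul_sum, Finset.mul_sum,
    ← Finset.sum_sub_distrib]
  refine Finset.sum_congr rfl fun c _ => ?_
  have hd : I.entryDen (index (.inr ((((((i, s), l), ρ), σ), τ), 1))) (index c) = 1 := by
    simp [entryDen, index]
  rw [bonus, hd, Nat.cast_one, mul_one, ← mul_assoc, mul_div_cancel₀ _ hp.ne']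
  have e1 : I.bonusPos (index (.inr ((((((i, s), l), ρ), σ), τ), 1))) (index c) =
      if τ = 0 then I.formPos (index (.inr ((((((i, s), l), ρ), σ), τ), 1))) (index c)
      else I.formNeg (index (.inr ((((((i, s), l), ρ), σ), τ), 1))) (index c) := by
    simp [bonusPos, index]
  have e2 : I.bonusNeg (index (.inr ((((((i, s), l), ρ), σ), τ), 1))) (index c) =
      (if τ = 0 then I.formNeg (index (.inr ((((((i, s), l), ρ), σ), τ), 1))) (index c)
      else I.formPos (index (.inr ((((((i, s), l), ρ), σ), τ), 1))) (index c)) +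
        I.selfCoef (index (.inr ((((((i, s), l), ρ), σ), τ), 1))) (index c) := by
    simp [bonusNeg, index]
  rw [e1, e2]
  split_ifs <;> push_cast <;> ring

/-- A gate column belongs to a single profile, so at most one summand is nonzero. This is why each
payoff entry can keep its own denominator. -/
theorem bonus_player (i : Fin I.k) (j : Fin I.n) (c : I.Strategy) :
    bonus (.inl (i, j)) c = ∑ s with digit s i = j, (I.num i s : ℝ) / I.den i s *
      (((I.prodPos i s I.k (index c) : ℝ) - I.prodNeg i s I.k (index c)) / 4 ^ I.R) := by
  have hk := I.k_pos.ne'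
  rcases c with ⟨i', j'⟩ | ⟨⟨⟨⟨⟨⟨i', s'⟩, l'⟩, ρ'⟩, σ'⟩, τ'⟩, bit'⟩
  · simp [bonus, bonusPos, bonusNeg, prodPos, prodNeg, prodMatch, index, eqInd, hk]
  · rw [Finset.sum_filter, Fintype.sum_eq_single s']
    · have hden : (0 : ℝ) < I.den i' s' := by exact_mod_cast I.den_pos _ i'.2 _ s'.2
      by_cases hi : i' = i
      · subst hi
        by_cases hj : digit s' i' = j
        · have hj' : (s' : ℕ) / I.n ^ (i' : ℕ) % I.n = j := by rw [← digit_val, hj]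
          simp only [bonus, bonusPos, bonusNeg, profileMatch, entryDen, index, eqInd, hj, hj',
            if_true]
          push_cast
          rw [pow_succ]
          field_simp
        · have hj' : ¬ (s' : ℕ) / I.n ^ (i' : ℕ) % I.n = j := fun h => hj (Fin.ext h)
          simp [bonus, bonusPos, bonusNeg, profileMatch, index, eqInd, hj, hj']
      · have hi' : ¬ (i' : ℕ) = i := fun h => hi (Fin.ext h)
        simp [bonus, bonusPos, bonusNeg, profileMatch, prodPos, prodNeg, prodMatch, index, eqInd,
          hi', hk]
    · intro s hs
      have hs' : ¬ (s' : ℕ) = s := fun h => hs (Fin.ext h).symm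
      simp [prodPos, prodNeg, prodMatch, index, eqInd, hs', hk]

theorem sum_bonus_player (hy1 : ∑ c, y c = 1) (i : Fin I.k) (j : Fin I.n) :
    ∑ c, bonus (.inl (i, j)) c * y c =
      ∑ s with digit s i = j, (I.num i s : ℝ) / I.den i s * productValue y i s I.k := by
  simp only [bonus_player, Finset.sum_mul]
  rw [Finset.sum_comm]
  refine Finset.sum_congr rfl fun s _ => ?_
  have h := sum_prod hy1 i s le_rfl
  have hp : (4 : ℝ) ^ I.R ≠ 0 := by positivity
  rw [← mul_div_cancel_left₀ (productValue y i s I.k) hp, ← h, Finset.sum_div, Finset.mul_sum]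
  exact Finset.sum_congr rfl fun c _ => by ring

end GameInstance

/-! ### Equilibria of the bimatrix game -/

namespace GameInstance

variable {I : GameInstance} {y : I.Strategy → ℝ}

/-- The mixed strategy of player `i` that is represented by `y`. -/
noncomputable def playerStrategy (y : I.Strategy → ℝ) (i : Fin I.k) (j : Fin I.n) : ℝ :=
  y (.inl (i, j)) / ∑ j', y (.inl (i, j'))

variable (y) in
/-- The exact factors. -/
noncomputable def exactFactor (i : Fin I.k) (s : Fin (I.n ^ I.k)) (l : Fin I.k) : ℝ :=
  if l = i then 1 else playerStrategy y l (digit s l)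

theorem prod_exactFactor (i : Fin I.k) (s : Fin (I.n ^ I.k)) :
    ∏ l' with l'.val < I.k, exactFactor y i s l' =
      ∏ l ∈ Finset.univ.erase i, playerStrategy y l (digit s l) := by
  rw [Finset.filter_true_of_mem fun l _ => l.2, ← Finset.mul_prod_erase _ _ (Finset.mem_univ i)]
  rw [exactFactor, if_pos rfl, one_mul]
  exact Finset.prod_congr rfl fun l hl => if_neg (Finset.ne_of_mem_erase hl)

variable (y) in
/-- The expected payoff of player `i` for the strategy `j` in the given game. -/
noncomputable def utility (i : Fin I.k) (j : Fin I.n) : ℝ :=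
  ∑ s with digit s i = j, (I.num i s : ℝ) / I.den i s *
    ∏ l ∈ Finset.univ.erase i, playerStrategy y l (digit s l)

/-- `y` is a mixed strategy that contains only `ε`-best responses to itself under the payoffs of
the row player. -/
structure IsSelfResponse (y : I.Strategy → ℝ) (ε : ℝ) : Prop where
  nonneg : ∀ c, 0 ≤ y c
  sum_eq_one : ∑ c, y c = 1
  response : ∀ r : I.Strategy, 0 < y r → ∀ r' : I.Strategy,
    ∑ c, (I.payoffNum (index r') (index c) : ℝ) / I.payoffDen (index r') (index c) * y c ≤
      ∑ c, (I.payoffNum (index r) (index c) : ℝ) / I.payoffDen (index r) (index c) * y c + ε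

variable (I) in
/-- The accuracy of the values of the gates. -/
noncomputable def gateError : ℝ := 1 / (256 * I.H)

theorem H_cast_ge_one : (1 : ℝ) ≤ I.H := by exact_mod_cast I.H_pos

theorem gateError_nonneg : 0 ≤ I.gateError := by unfold gateError; positivity

theorem gateError_le : I.gateError ≤ 1 / 256 := by
  have := I.H_cast_ge_one
  unfold gateError
  exact one_div_le_one_div_of_le (by norm_num) (by linarith)

theorem H_mul_gateError : I.H * I.gateError = 1 / 256 := by
  have := I.H_cast_ge_one
  unfold gateError
  field_simp

/-- The summands of `R = W + b + 4` pay for the factors `W`, `2 ^ b` and `256`. -/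
theorem one_div_four_pow_R_le : 1 / 4 ^ I.R ≤ I.gateError := by
  have h : 256 * I.H ≤ 4 ^ I.R := by
    have h1 : I.W ≤ 4 ^ I.W := (Nat.lt_pow_self (by norm_num)).le
    have h2 : 2 ^ I.b ≤ 4 ^ I.b := Nat.pow_le_pow_left (by norm_num) _
    have h3 := Nat.mul_le_mul h1 h2
    unfold R H
    rw [pow_add, pow_add]
    omega
  have h' : (256 : ℝ) * I.H ≤ 4 ^ I.R := by exact_mod_cast h
  have := I.H_cast_ge_one
  exact one_div_le_one_div_of_le (by linarith) h'

theorem sum_payoff (hy1 : ∑ c, y c = 1) (r : I.Strategy) :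
    ∑ c, (I.payoffNum (index r) (index c) : ℝ) / I.payoffDen (index r) (index c) * y c =
      (2 * I.M + (∑ c, bonus r c * y c - I.M * blockMass block y (block r))) / (4 * I.M) := by
  simp only [payoff_eq, blockMass, Finset.sum_filter, Finset.mul_sum]
  have h : (2 * I.M : ℝ) = ∑ c, 2 * I.M * y c := by rw [← Finset.mul_sum, hy1, mul_one]
  conv_rhs => rw [h]
  rw [← Finset.sum_sub_distrib, ← Finset.sum_add_distrib, Finset.sum_div]
  refine Finset.sum_congr rfl fun c _ => ?_
  split_ifs <;> ring

namespace IsSelfResponse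

/-- Undoing the scaling of the payoffs multiplies the accuracy by `4 * M`. The constant `2 ^ 33` and
the exponent `8` make the result exactly half of `gateError`. -/
theorem bonus_response (hy : IsSelfResponse y (1 / (2 ^ 33 * (I.H : ℝ) ^ 8)))
    (r : I.Strategy) (hr : 0 < y r) (r' : I.Strategy) :
    ∑ c, bonus r' c * y c - I.M * blockMass block y (block r') ≤
      ∑ c, bonus r c * y c - I.M * blockMass block y (block r) + I.gateError / 2 := by
  have h := hy.response r hr r'
  have hM : (0 : ℝ) < I.M := by exact_mod_cast I.M_pos
  have hH := I.H_cast_ge_one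
  rw [sum_payoff hy.sum_eq_one, sum_payoff hy.sum_eq_one, div_le_iff₀ (by positivity), add_mul,
    div_mul_cancel₀ _ (by positivity)] at h
  have e : 1 / (2 ^ 33 * (I.H : ℝ) ^ 8) * (4 * I.M) = I.gateError / 2 := by
    unfold gateError M
    push_cast
    field_simp
    norm_num
  rw [e] at h
  linarith

/-- The choice of `M` is made for this: `8 * K ^ 2 ≤ 5000 * H ^ 6`, while half of `gateError` times
`M` is `8192 * H ^ 6`. -/
theorem abs_mass_sub_one_le (hy : IsSelfResponse y (1 / (2 ^ 33 * (I.H : ℝ) ^ 8)))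
    (v : I.Block) :
    |I.K * blockMass block y v - 1| ≤ I.gateError / 2 := by
  have hM : (0 : ℝ) < I.M := by exact_mod_cast I.M_pos
  have hH := I.H_cast_ge_one
  have hδ := I.gateError_nonneg
  have hδ' := I.gateError_le
  have h := abs_card_mul_blockMass_sub_one_le block block_surjective hy.nonneg hy.sum_eq_one
    abs_bonus_le hM (by positivity : 0 ≤ I.gateError / 2) hy.bonus_response v
  rw [card_block] at h
  refine h.trans ?_
  have hK : (I.K : ℝ) ≤ 25 * I.H ^ 3 := by exact_mod_cast I.K_le
  have hK1 : (1 : ℝ) ≤ I.K := by exact_mod_cast I.K_pos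
  rw [← mul_div_assoc, div_le_iff₀ hM]
  have e : I.gateError / 2 * I.M = 2 ^ 13 * I.H ^ 6 := by
    unfold gateError M
    push_cast
    field_simp
    norm_num
  rw [e]
  have h1 : (I.K : ℝ) * I.K ≤ 25 * I.H ^ 3 * (25 * I.H ^ 3) :=
    mul_le_mul hK hK (by positivity) (by positivity)
  nlinarith

theorem abs_playerMass_sub_one_le (hy : IsSelfResponse y (1 / (2 ^ 33 * (I.H : ℝ) ^ 8)))
    (i : Fin I.k) :
    |I.K * ∑ j, y (.inl (i, j)) - 1| ≤ I.gateError / 2 := by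
  have h := hy.abs_mass_sub_one_le (.inl i)
  have e : blockMass block y (.inl i) = ∑ j, y (.inl (i, j)) := by
    rw [blockMass, Finset.sum_filter, Fintype.sum_sum_type, Fintype.sum_prod_type,
      Fintype.sum_eq_single i]
    · simp [block]
    · intro i' hi'
      simp [block, hi']
  rwa [e] at h

theorem abs_gateMass_sub_one_le (hy : IsSelfResponse y (1 / (2 ^ 33 * (I.H : ℝ) ^ 8)))
    (v : I.Gate) :
    |I.K * y (.inr (v, 0)) + I.K * y (.inr (v, 1)) - 1| ≤ I.gateError / 2 := by
  have h := hy.abs_mass_sub_one_le (.inr v)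
  have e : blockMass block y (.inr v) = y (.inr (v, 0)) + y (.inr (v, 1)) := by
    rw [blockMass, Finset.sum_filter, Fintype.sum_sum_type, Fintype.sum_prod_type (γ := ℝ),
      Fintype.sum_prod_type (α₁ := I.Gate), Fintype.sum_eq_single v]
    · simp [block, Fin.sum_univ_two]
    · intro v' hv'
      simp [block, hv']
  rwa [e, mul_add] at h

/-- Both strategies of a gate lie in one block, so the penalties cancel and only their bonuses are
compared. -/
theorem abs_gateValue_sub_le (hy : IsSelfResponse y (1 / (2 ^ 33 * (I.H : ℝ) ^ 8)))
    (i : Fin I.k) (s : Fin (I.n ^ I.k)) (l : Fin I.k) (σ τ : Fin 2)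
    {ρ : ℕ} (hρ : ρ < I.R) : |gateValue y i s l σ τ ρ -
      unitClamp ((if τ = 0 then 1 else -1) * formValue y i s l σ ρ)| ≤ I.gateError := by
  have hK : (0 : ℝ) < I.K := by exact_mod_cast I.K_pos
  have hδ := I.gateError_nonneg
  have hv : gateValue y i s l σ τ ρ = I.K * y (.inr ((((((i, s), l), ⟨ρ, hρ⟩), σ), τ), 1)) := by
    rw [gateValue, dif_pos hρ]
  have h0 := sum_bonus_gate_zero (y := y) (((((i, s), l), ⟨ρ, hρ⟩), σ), τ)
  have h1 := sum_bonus_gate_one hy.sum_eq_one i s l ⟨ρ, hρ⟩ σ τ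
  have hm := hy.abs_gateMass_sub_one_le (((((i, s), l), ⟨ρ, hρ⟩), σ), τ)
  rw [← hv] at hm
  have key := abs_sub_unitClamp_le (L := (if τ = 0 then 1 else -1) * formValue y i s l σ ρ)
    (ε := I.gateError / 2) (by rw [hv]; exact mul_nonneg hK.le (hy.nonneg _))
    (mul_nonneg hK.le (hy.nonneg _)) (by positivity) hm ?_ ?_
  · linarith
  · intro hpos
    rw [hv] at hpos
    have := hy.bonus_response _ (pos_of_mul_pos_right hpos hK.le)
      (.inr ((((((i, s), l), ⟨ρ, hρ⟩), σ), τ), 0))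
    rw [h0, h1] at this
    simp only [block] at this
    linarith
  · intro hpos
    have := hy.bonus_response _ (pos_of_mul_pos_right hpos hK.le)
      (.inr ((((((i, s), l), ⟨ρ, hρ⟩), σ), τ), 1))
    rw [h0, h1] at this
    simp only [block] at this
    linarith

theorem gateValue_nonneg (hy : IsSelfResponse y (1 / (2 ^ 33 * (I.H : ℝ) ^ 8)))
    (i : Fin I.k) (s : Fin (I.n ^ I.k)) (l : Fin I.k) (σ τ : Fin 2)
    (ρ : ℕ) : 0 ≤ gateValue y i s l σ τ ρ := by
  unfold gateValue
  split_ifs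
  · exact mul_nonneg (Nat.cast_nonneg _) (hy.nonneg _)
  · exact le_rfl

theorem iterateValue_nonneg (hy : IsSelfResponse y (1 / (2 ^ 33 * (I.H : ℝ) ^ 8)))
    (i : Fin I.k) (s : Fin (I.n ^ I.k)) (l : Fin I.k) (σ : Fin 2)
    (ρ : ℕ) : 0 ≤ iterateValue y i s l σ ρ :=
  add_nonneg (hy.gateValue_nonneg i s l σ 0 ρ) (hy.gateValue_nonneg i s l σ 1 ρ)

theorem abs_iterateValue_sub_le (hy : IsSelfResponse y (1 / (2 ^ 33 * (I.H : ℝ) ^ 8)))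
    (i : Fin I.k) (s : Fin (I.n ^ I.k)) (l : Fin I.k) (σ : Fin 2)
    {ρ : ℕ} (hρ : ρ < I.R) :
    |iterateValue y i s l σ ρ - min 1 (|formValue y i s l σ ρ|)| ≤ 2 * I.gateError :=
  abs_add_sub_min_abs_le (by simpa using hy.abs_gateValue_sub_le i s l σ 0 hρ)
    (by simpa using hy.abs_gateValue_sub_le i s l σ 1 hρ)

theorem playerMass_pos (hy : IsSelfResponse y (1 / (2 ^ 33 * (I.H : ℝ) ^ 8)))
    (i : Fin I.k) : 0 < ∑ j, y (.inl (i, j)) := by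
  have h := abs_le.1 (hy.abs_playerMass_sub_one_le i)
  have hδ := I.gateError_le
  have hK : (0 : ℝ) ≤ I.K := Nat.cast_nonneg _
  exact pos_of_mul_pos_right (by linarith : 0 < I.K * ∑ j, y (.inl (i, j))) hK

theorem playerStrategy_mem (hy : IsSelfResponse y (1 / (2 ^ 33 * (I.H : ℝ) ^ 8)))
    (i : Fin I.k) : playerStrategy y i ∈ stdSimplex ℝ (Fin I.n) :=
  ⟨fun j => div_nonneg (hy.nonneg _) (hy.playerMass_pos i).le, by
    simp only [playerStrategy]
    rw [← Finset.sum_div, div_self (hy.playerMass_pos i).ne']⟩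

theorem playerStrategy_le_one (hy : IsSelfResponse y (1 / (2 ^ 33 * (I.H : ℝ) ^ 8)))
    (i : Fin I.k) (j : Fin I.n) : playerStrategy y i j ≤ 1 := by
  rw [← (hy.playerStrategy_mem i).2]
  exact Finset.single_le_sum (fun j _ => (hy.playerStrategy_mem i).1 j) (Finset.mem_univ j)

/-- A linear form can multiply by `K` but not divide by the mass of a block. As this mass is about
`1 / K`, the two nearly agree. -/
theorem abs_sub_playerStrategy_le (hy : IsSelfResponse y (1 / (2 ^ 33 * (I.H : ℝ) ^ 8)))
    (i : Fin I.k) (j : Fin I.n) :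
    |I.K * y (.inl (i, j)) - playerStrategy y i j| ≤ I.gateError / 2 := by
  have h := hy.abs_playerMass_sub_one_le i
  have hp := hy.playerStrategy_le_one i j
  have hp0 : 0 ≤ playerStrategy y i j := (hy.playerStrategy_mem i).1 j
  have e : I.K * y (.inl (i, j)) - playerStrategy y i j =
      playerStrategy y i j * (I.K * ∑ j, y (.inl (i, j)) - 1) := by
    have := (hy.playerMass_pos i).ne'
    rw [playerStrategy]
    field_simp
  rw [e, abs_mul, abs_of_nonneg hp0]
  exact (mul_le_of_le_one_left (abs_nonneg _) hp).trans h

theorem exactFactor_nonneg (hy : IsSelfResponse y (1 / (2 ^ 33 * (I.H : ℝ) ^ 8)))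
    (i : Fin I.k) (s : Fin (I.n ^ I.k)) (l : Fin I.k) :
    0 ≤ exactFactor y i s l := by
  unfold exactFactor
  split_ifs
  · exact zero_le_one
  · exact (hy.playerStrategy_mem l).1 _

theorem exactFactor_le_one (hy : IsSelfResponse y (1 / (2 ^ 33 * (I.H : ℝ) ^ 8)))
    (i : Fin I.k) (s : Fin (I.n ^ I.k)) (l : Fin I.k) :
    exactFactor y i s l ≤ 1 := by
  unfold exactFactor
  split_ifs
  · exact le_rfl
  · exact hy.playerStrategy_le_one l _

theorem abs_factorValue_sub_le (hy : IsSelfResponse y (1 / (2 ^ 33 * (I.H : ℝ) ^ 8)))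
    (i : Fin I.k) (s : Fin (I.n ^ I.k)) (l : Fin I.k) :
    |factorValue y i s l - exactFactor y i s l| ≤ I.gateError / 2 := by
  have hδ := I.gateError_nonneg
  unfold factorValue exactFactor
  split_ifs
  · simpa using div_nonneg hδ zero_le_two
  · exact hy.abs_sub_playerStrategy_le l _

theorem factorValue_nonneg (hy : IsSelfResponse y (1 / (2 ^ 33 * (I.H : ℝ) ^ 8)))
    (i : Fin I.k) (s : Fin (I.n ^ I.k)) (l : Fin I.k) :
    0 ≤ factorValue y i s l := by
  unfold factorValue
  split_ifs
  · exact zero_le_one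
  · exact mul_nonneg (Nat.cast_nonneg _) (hy.nonneg _)

/-- One multiplication. -/
theorem abs_productValue_succ_sub_le (hy : IsSelfResponse y (1 / (2 ^ 33 * (I.H : ℝ) ^ 8)))
    (i : Fin I.k) (s : Fin (I.n ^ I.k)) (l : Fin I.k)
    (ht : |productValue y i s l| ≤ 3 / 2) :
    |productValue y i s (l + 1) - productValue y i s l * factorValue y i s l| ≤
      96 * I.gateError := by
  have hδ := I.gateError_nonneg
  have hδ' := I.gateError_le
  have hq := abs_le.1 (hy.abs_factorValue_sub_le i s l)
  have hq1 := hy.exactFactor_le_one i s l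
  have hR : 0 < I.R := Nat.succ_pos _
  have key := abs_sum_iterates_sub_mul_le hδ (by linarith) hR ht (hy.factorValue_nonneg i s l)
    (by linarith) (iterateValue y i s l 0) (iterateValue y i s l 1)
    (fun ρ _ => hy.iterateValue_nonneg i s l 0 ρ) (fun ρ _ => hy.iterateValue_nonneg i s l 1 ρ)
    (by simpa [formValue] using hy.abs_iterateValue_sub_le i s l 0 hR)
    (by simpa [formValue, ← sub_eq_add_neg] using hy.abs_iterateValue_sub_le i s l 1 hR)
    (fun ρ hρ => hy.abs_iterateValue_sub_le i s l 0 hρ)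
    (fun ρ hρ => hy.abs_iterateValue_sub_le i s l 1 hρ)
  have h4 := I.one_div_four_pow_R_le
  have e : (16 : ℝ) / 4 ^ I.R = 16 * (1 / 4 ^ I.R) := by ring
  rw [e] at key
  rw [productValue, dif_pos l.2]
  simp only [Fin.eta]
  linarith

/-- Errors add up. In units of `gateError`, a factor costs `96` for the multiplication, `1 / 2` for
its own error, and at most `1 / 2` because it may slightly exceed `1` and magnify the earlier error.
-/
theorem abs_productValue_sub_le (hy : IsSelfResponse y (1 / (2 ^ 33 * (I.H : ℝ) ^ 8)))
    (i : Fin I.k) (s : Fin (I.n ^ I.k)) {l : ℕ} (hl : l ≤ I.k) :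
    |productValue y i s l - ∏ l' with l'.val < l, exactFactor y i s l'| ≤
      l * (98 * I.gateError) := by
  have hδ := I.gateError_nonneg
  have hδ' := I.gateError_le
  induction l with
  | zero => simp [productValue]
  | succ l ih =>
    have hlk : l < I.k := hl
    have ih := ih hlk.le
    set e := ∏ l' with l'.val < l, exactFactor y i s l' with he
    have he0 : 0 ≤ e := Finset.prod_nonneg fun l' _ => hy.exactFactor_nonneg i s l'
    have he1 : e ≤ 1 := Finset.prod_le_one (fun l' _ => hy.exactFactor_nonneg i s l')
      fun l' _ => hy.exactFactor_le_one i s l'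
    have hstep : ∏ l' with l'.val < l + 1, exactFactor y i s l' =
        exactFactor y i s ⟨l, hlk⟩ * e := by
      rw [he, ← Finset.prod_insert (by simp)]
      congr 1
      ext l'
      simp only [Finset.mem_filter, Finset.mem_univ, true_and, Finset.mem_insert, Fin.ext_iff]
      omega
    -- This keeps the partial product within the range `3 / 2` in which the multiplication is
    -- accurate.
    have hsmall : l * (98 * I.gateError) ≤ 1 / 2 := by
      have h1 : (l : ℝ) ≤ I.H := by
        exact_mod_cast (hlk.le.trans I.k_le_W).trans I.W_le_H
      have h2 := I.H_mul_gateError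
      nlinarith
    have ih' := abs_le.1 ih
    have ht : |productValue y i s l| ≤ 3 / 2 := abs_le.2 ⟨by linarith, by linarith⟩
    have hm := abs_le.1 (hy.abs_productValue_succ_sub_le i s ⟨l, hlk⟩ ht)
    have hq := abs_le.1 (hy.abs_factorValue_sub_le i s ⟨l, hlk⟩)
    have hq0 := hy.factorValue_nonneg i s ⟨l, hlk⟩
    have hq1 := hy.exactFactor_le_one i s ⟨l, hlk⟩
    simp only at hm
    rw [hstep]
    generalize productValue y i s l = t at *
    generalize productValue y i s (l + 1) = t' at *
    generalize factorValue y i s ⟨l, hlk⟩ = q at *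
    generalize exactFactor y i s ⟨l, hlk⟩ = q' at *
    have h1 : |(t - e) * q| ≤ l * (98 * I.gateError) + I.gateError / 2 := by
      rw [abs_mul, abs_of_nonneg hq0]
      nlinarith [abs_nonneg (t - e), mul_le_mul_of_nonneg_left
        (by linarith : q ≤ 1 + I.gateError / 2) (abs_nonneg (t - e))]
    have h2 : |e * (q - q')| ≤ I.gateError / 2 := by
      rw [abs_mul, abs_of_nonneg he0]
      exact (mul_le_of_le_one_left (abs_nonneg _) he1).trans (abs_le.2 hq)
    have h1 := abs_le.1 h1
    have h2 := abs_le.1 h2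
    push_cast
    rw [abs_le]
    constructor <;> nlinarith

theorem abs_sum_bonus_sub_utility_le (hy : IsSelfResponse y (1 / (2 ^ 33 * (I.H : ℝ) ^ 8)))
    (i : Fin I.k) (j : Fin I.n) :
    |∑ c, bonus (.inl (i, j)) c * y c - utility y i j| ≤ I.W * (98 * I.gateError) := by
  have hδ := I.gateError_nonneg
  rw [sum_bonus_player hy.sum_eq_one, utility, ← Finset.sum_sub_distrib]
  calc _ ≤ ∑ s with digit s i = j, |(I.num i s : ℝ) / I.den i s * productValue y i s I.k -
          (I.num i s : ℝ) / I.den i s *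
            ∏ l ∈ Finset.univ.erase i, playerStrategy y l (digit s l)| :=
        Finset.abs_sum_le_sum_abs _ _
    _ ≤ ∑ s : Fin (I.n ^ I.k) with digit s i = j, I.k * (98 * I.gateError) := by
        refine Finset.sum_le_sum fun s _ => ?_
        have hden : (0 : ℝ) < I.den i s := by exact_mod_cast I.den_pos _ i.2 _ s.2
        have hnum : (I.num i s : ℝ) ≤ I.den i s := by exact_mod_cast I.num_le _ i.2 _ s.2
        rw [← mul_sub, abs_mul, abs_of_nonneg (by positivity), ← prod_exactFactor]
        exact (mul_le_of_le_one_left (abs_nonneg _) ((div_le_one hden).2 hnum)).trans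
          (hy.abs_productValue_sub_le i s le_rfl)
    _ ≤ I.n ^ I.k * (I.k * (98 * I.gateError)) := by
        rw [Finset.sum_const, nsmul_eq_mul]
        refine mul_le_mul_of_nonneg_right ?_ (by positivity)
        have := Finset.card_filter_le (Finset.univ : Finset (Fin (I.n ^ I.k)))
          (fun s => digit s i = j)
        rw [Finset.card_univ, Fintype.card_fin] at this
        exact_mod_cast this
    _ = I.W * (98 * I.gateError) := by
        unfold W
        push_cast
        ring

/-- The players play only approximate best responses. -/
theorem utility_le (hy : IsSelfResponse y (1 / (2 ^ 33 * (I.H : ℝ) ^ 8)))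
    (i : Fin I.k) (j : Fin I.n) (hj : 0 < playerStrategy y i j) (j' : Fin I.n) :
    utility y i j' ≤ utility y i j + 1 / 2 ^ I.b := by
  have hpos : 0 < y (.inl (i, j)) := by
    refine lt_of_le_of_ne (hy.nonneg _) fun h => ?_
    rw [playerStrategy, ← h, zero_div] at hj
    exact hj.false
  have h := hy.bonus_response _ hpos (.inl (i, j'))
  simp only [block] at h
  have h1 := abs_le.1 (hy.abs_sum_bonus_sub_utility_le i j)
  have h2 := abs_le.1 (hy.abs_sum_bonus_sub_utility_le i j')
  have h3 : I.W * I.gateError = 1 / 256 * (1 / 2 ^ I.b) := by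
    have : (I.W : ℝ) ≠ 0 := by exact_mod_cast I.W_pos.ne'
    unfold gateError H
    push_cast
    field_simp
  have h4 : I.gateError ≤ I.W * I.gateError :=
    le_mul_of_one_le_left I.gateError_nonneg (by exact_mod_cast I.W_pos)
  have h5 : (0 : ℝ) ≤ 1 / 2 ^ I.b := by positivity
  -- In units of `1 / 2 ^ b` the total error is at most `(2 * 98 + 1 / 2) / 256 < 1`.
  nlinarith

end IsSelfResponse

end GameInstance

/-! ### The direct reduction -/

section TwoPlayers

variable {N : ℕ} (G : NormalFormGame 2 N) (q : Fin 2 → Fin N → ℝ)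

theorem NormalFormGame.expectedPayoff_two_zero (r : Fin N) :
    G.expectedPayoff q 0 r = ∑ c, (G.payoff 0 ![r, c] : ℝ) * q 1 c := by
  have h : (Finset.univ.erase (0 : Fin 2)) = {1} := by decide
  simp only [expectedPayoff, h, Finset.prod_singleton, Finset.sum_filter]
  rw [← Equiv.sum_comp (finTwoArrowEquiv (Fin N)).symm, Fintype.sum_prod_type,
    Fintype.sum_eq_single r]
  · simp
  · intro r' hr'
    simp [hr']

theorem NormalFormGame.expectedPayoff_two_one (c : Fin N) :
    G.expectedPayoff q 1 c = ∑ r, (G.payoff 1 ![r, c] : ℝ) * q 0 r := by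
  have h : (Finset.univ.erase (1 : Fin 2)) = {0} := by decide
  simp only [expectedPayoff, h, Finset.prod_singleton, Finset.sum_filter]
  rw [← Equiv.sum_comp (finTwoArrowEquiv (Fin N)).symm, Fintype.sum_prod_type_right,
    Fintype.sum_eq_single c]
  · simp
  · intro c' hc'
    simp [hc']

end TwoPlayers

theorem exists_one_div_le_of_mem_stdSimplex {N : ℕ} {x : Fin N → ℝ}
    (hx : x ∈ stdSimplex ℝ (Fin N)) : ∃ i, 1 / (N : ℝ) ≤ x i := by
  have hN : N ≠ 0 := by
    rintro rfl
    simpa using hx.2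
  have : NeZero N := ⟨hN⟩
  have hN' : (0 : ℝ) < N := by positivity
  by_contra! h
  have hs : ∑ i, x i < ∑ _i : Fin N, 1 / (N : ℝ) :=
    Finset.sum_lt_sum_of_nonempty Finset.univ_nonempty fun i _ => h i
  rw [hx.2, Finset.sum_const, Finset.card_univ, Fintype.card_fin, nsmul_eq_mul,
    mul_one_div_cancel hN'.ne'] at hs
  exact hs.false

/-! ### The bimatrix game with an imitating column player. -/

namespace GameInstance

variable (I : GameInstance)

/-- The bimatrix game: the column player imitates the row player. -/
def bimatrixGame : NormalFormGame 2 I.N where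
  payoff i s := if i = 0 then
      (I.payoffNum (I.decode (s 0)) (I.decode (s 1)) : ℚ) /
        I.payoffDen (I.decode (s 0)) (I.decode (s 1))
    else eqInd (s 0) (s 1)
  payoff_mem i s := by
    obtain ⟨r, hr⟩ := encode.surjective (s 0)
    obtain ⟨c, hc⟩ := encode.surjective (s 1)
    split_ifs
    · rw [← hr, ← hc, decode_encode, decode_encode]
      have h : (0 : ℚ) < I.payoffDen (index r) (index c) := by exact_mod_cast payoffDen_pos r c
      exact ⟨by positivity, (div_le_one h).2 (by exact_mod_cast payoffNum_le r c)⟩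
    · exact ⟨by positivity, by exact_mod_cast eqInd_le_one _ _⟩

/-- The mapping of the strategies. -/
def mapping : GameMapping I.k I.n 2 I.N where
  g _ := 1
  h i j := encode (.inl (i, j))
  h_injective i j j' h := by simpa using encode.injective h

theorem isGameCode_bimatrixData : IsGameCode I.bimatrixGame I.bimatrixData := by
  refine ⟨fun i s => if i = 0 then
    .pair (.nat (I.payoffNum (I.decode (s 0)) (I.decode (s 1))))
      (.nat (I.payoffDen (I.decode (s 0)) (I.decode (s 1))))
    else .pair (.nat (eqInd (s 0) (s 1))) (.nat 1), fun i s => ?_, ?_⟩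
  · obtain ⟨r, hr⟩ := encode.surjective (s 0)
    obtain ⟨c, hc⟩ := encode.surjective (s 1)
    by_cases hi : i = 0
    · refine ⟨_, _, ?_, if_pos hi, if_pos hi⟩
      rw [← hr, ← hc, decode_encode, decode_encode]
      exact payoffDen_pos r c
    · exact ⟨_, 1, one_pos, by simp [bimatrixGame, hi], if_neg hi⟩
  · have h0 : ∀ l : Fin (I.N ^ 2), ((finFunctionFinEquiv.symm l 0 : Fin I.N) : ℕ) = l % I.N := by
      intro l
      change (l : ℕ) / I.N ^ 0 % I.N = l % I.N
      rw [pow_zero, Nat.div_one]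
    have h1 : ∀ l : Fin (I.N ^ 2), ((finFunctionFinEquiv.symm l 1 : Fin I.N) : ℕ) = l / I.N := by
      intro l
      change (l : ℕ) / I.N ^ 1 % I.N = l / I.N
      rw [pow_one, Nat.mod_eq_of_lt]
      exact Nat.div_lt_of_lt_mul (by rw [← sq]; exact l.2)
    simp [bimatrixData, rowTable, columnTable, List.ofFn_succ, h0, h1]

theorem isRatCode_accuracyData : IsRatCode (1 / (2 ^ 33 * (I.H : ℚ) ^ 8)) I.accuracyData :=
  ⟨1, 2 ^ 33 * I.H ^ 8, Nat.mul_pos (by norm_num) (pow_pos H_pos _), by push_cast; rfl, rfl⟩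

variable {I}

theorem bimatrixGame_expectedPayoff_zero (q : Fin 2 → Fin I.N → ℝ) (r : I.Strategy) :
    I.bimatrixGame.expectedPayoff q 0 (encode r) =
      ∑ c, (I.payoffNum (index r) (index c) : ℝ) / I.payoffDen (index r) (index c) *
        q 1 (encode c) := by
  rw [NormalFormGame.expectedPayoff_two_zero, ← Equiv.sum_comp encode]
  refine Finset.sum_congr rfl fun c _ => ?_
  simp [bimatrixGame, decode_encode]

theorem bimatrixGame_expectedPayoff_one (q : Fin 2 → Fin I.N → ℝ) (c : Fin I.N) :
    I.bimatrixGame.expectedPayoff q 1 c = q 0 c := by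
  rw [NormalFormGame.expectedPayoff_two_one, Fintype.sum_eq_single c]
  · simp [bimatrixGame, eqInd]
  · intro r hr
    simp [bimatrixGame, eqInd, Fin.val_inj, hr]

theorem accuracy_lt_one_div_N : 1 / (2 ^ 33 * (I.H : ℝ) ^ 8) < 1 / I.N := by
  have hN : 0 < I.N := Nat.add_pos_left (Nat.mul_pos I.k_pos I.n_pos) _
  have h : I.N < 2 ^ 33 * I.H ^ 8 := by
    have h1 := I.N_le
    have h2 : I.H ^ 3 ≤ I.H ^ 8 := Nat.pow_le_pow_right H_pos (by norm_num)
    have h3 : 0 < I.H ^ 8 := pow_pos H_pos _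
    omega
  exact one_div_lt_one_div_of_lt (by exact_mod_cast hN) (by exact_mod_cast h)

/-- Some row has mass at least `1 / N`, which exceeds the accuracy. So every column that is played
has positive row mass, and the equilibrium condition of the row player applies to it. -/
theorem isSelfResponse_of_isWellSupportedNash {q : Fin 2 → Fin I.N → ℝ}
    (hq : I.bimatrixGame.IsWellSupportedNash (1 / (2 ^ 33 * (I.H : ℝ) ^ 8)) q) :
    IsSelfResponse (fun c : I.Strategy => q 1 (encode c)) (1 / (2 ^ 33 * (I.H : ℝ) ^ 8)) where
  nonneg c := (hq.1 1).1 _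
  sum_eq_one := by
    rw [Equiv.sum_comp encode]
    exact (hq.1 1).2
  response r hr r' := by
    obtain ⟨c, hc⟩ := exists_one_div_le_of_mem_stdSimplex (hq.1 0)
    have h := hq.2 1 _ hr c
    rw [bimatrixGame_expectedPayoff_one, bimatrixGame_expectedPayoff_one] at h
    have h' := hq.2 0 (encode r) (by linarith [I.accuracy_lt_one_div_N]) (encode r')
    rwa [bimatrixGame_expectedPayoff_zero, bimatrixGame_expectedPayoff_zero] at h'

theorem isDirectReduction_mapping (G : NormalFormGame I.k I.n)
    (hG : ∀ i s, G.payoff i (finFunctionFinEquiv.symm s) = (I.num i s : ℚ) / I.den i s) {ε : ℝ}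
    (hε : 1 / 2 ^ I.b ≤ ε) :
    I.mapping.IsDirectReduction G ε I.bimatrixGame (1 / (2 ^ 33 * (I.H : ℝ) ^ 8)) := by
  intro q hq
  have hy := isSelfResponse_of_isWellSupportedNash hq
  -- Definitional, since the mapping sends all players to the column player.
  have hp : I.mapping.renormalize q = playerStrategy fun c : I.Strategy => q 1 (encode c) := rfl
  rw [hp]
  have hu : ∀ i j, G.expectedPayoff (playerStrategy fun c : I.Strategy => q 1 (encode c)) i j =
      utility (fun c : I.Strategy => q 1 (encode c)) i j := by
    intro i j
    rw [NormalFormGame.expectedPayoff, Finset.sum_filter,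
      ← Equiv.sum_comp finFunctionFinEquiv.symm, utility, Finset.sum_filter]
    refine Finset.sum_congr rfl fun s _ => ?_
    rw [hG]
    push_cast
    rfl
  refine ⟨hy.playerStrategy_mem, fun i j hj j' => ?_⟩
  rw [hu, hu]
  linarith [hy.utility_le i j hj j']

/-- The instance with given tables of numerators and denominators. -/
def ofTables {k n : ℕ} (hk : 0 < k) (hn : 0 < n) (b : ℕ) (num den : Fin k → Fin (n ^ k) → ℕ)
    (hden : ∀ i s, 0 < den i s) (hnum : ∀ i s, num i s ≤ den i s) : GameInstance where
  k := k
  n := n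
  b := b
  num i s := if h : i < k ∧ s < n ^ k then num ⟨i, h.1⟩ ⟨s, h.2⟩ else 0
  den i s := if h : i < k ∧ s < n ^ k then den ⟨i, h.1⟩ ⟨s, h.2⟩ else 0
  k_pos := hk
  n_pos := hn
  den_pos i hi s hs := by rw [dif_pos ⟨hi, hs⟩]; exact hden _ _
  num_le i hi s hs := by rw [dif_pos ⟨hi, hs⟩, dif_pos ⟨hi, hs⟩]; exact hnum _ _
  num_out i s h := dif_neg h
  den_out i s h := dif_neg h

end GameInstance

/-! ### Rounding the accuracy to a power of two, and the theorem. -/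

theorem one_div_two_pow_accuracyBits_le {ε : ℝ} (hε : 0 < ε) :
    1 / 2 ^ accuracyBits ε ≤ ε := by
  have h : Real.logb 2 (1 / ε) ≤ (accuracyBits ε : ℝ) := Nat.le_ceil _
  rw [Real.logb_le_iff_le_rpow (by norm_num) (by positivity), Real.rpow_natCast] at h
  rw [one_div_le (by positivity) hε]
  exact h

theorem le_two_div_two_pow_accuracyBits {ε : ℝ} (hε : 0 < ε) (hε' : ε < 1) :
    ε ≤ 2 / 2 ^ accuracyBits ε := by
  have h0 : 0 ≤ Real.logb 2 (1 / ε) :=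
    Real.logb_nonneg (by norm_num) (by rw [le_div_iff₀ hε]; linarith)
  have h1 : (accuracyBits ε : ℝ) < Real.logb 2 (1 / ε) + 1 := Nat.ceil_lt_add_one h0
  have h : (accuracyBits ε : ℝ) - 1 ≤ Real.logb 2 (1 / ε) := by linarith
  rw [Real.le_logb_iff_rpow_le (by norm_num) (by positivity), Real.rpow_sub_one (by norm_num),
    Real.rpow_natCast] at h
  rw [le_div_iff₀ (by positivity), mul_comm, ← le_div_iff₀ hε]
  rw [div_le_iff₀ (by norm_num)] at h
  linarith [h, show 1 / ε * 2 = 2 / ε by ring]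

theorem theorem1 :
    ∃ (P : Prog) (T : Polynomial ℕ) (c : ℝ) (d : ℕ), 0 < c ∧ 1 ≤ d ∧
      ∀ (k n : ℕ) (G : NormalFormGame k n) (x : Data) (ε : ℝ),
        1 ≤ k → 1 ≤ n → IsGameCode G x → 0 < ε → ε < 1 →
        ∃ (N : ℕ) (G₂ : NormalFormGame 2 N) (ε₂ : ℚ) (φ : GameMapping k n 2 N)
          (y z : Data) (t : ℕ),
          IsGameCode G₂ y ∧ IsRatCode ε₂ z ∧
          P.Runs (.pair x (.nat (accuracyBits ε))) (.pair y (.pair z φ.code)) t ∧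
          t ≤ T.eval (x.size + accuracyBits ε) ∧
          c * (ε / (G.entries : ℝ)) ^ d ≤ (ε₂ : ℝ) ∧
          (ε₂ : ℝ) ≤ (ε / (G.entries : ℝ)) ^ d ∧
          φ.IsDirectReduction G ε G₂ (ε₂ : ℝ) := by
  obtain ⟨P, τ, ⟨T, hT⟩, hP⟩ := GameInstance.available.output
  -- Rounding `ε` to `1 / 2 ^ b` loses at most a factor `2`, so its eighth power costs `2 ^ 8` on
  -- top of `2 ^ 33`.
  refine ⟨P, T, 1 / 2 ^ 41, 8, by positivity, by norm_num, ?_⟩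
  intro k n G x ε hk hn hx hε hε'
  obtain ⟨entry, hentry, rfl⟩ := hx
  choose num den hden hpay hdata using hentry
  have hnum : ∀ i s, num i s ≤ den i s := by
    intro i s
    have h := (G.payoff_mem i s).2
    rw [hpay, div_le_one (by exact_mod_cast hden i s)] at h
    exact_mod_cast h
  -- The numerators and denominators are those of the given description, possibly not in lowest
  -- terms, so that `I.gameData` is the actual input.
  let I : GameInstance := .ofTables hk hn (accuracyBits ε)
    (fun i s => num i (finFunctionFinEquiv.symm s)) (fun i s => den i (finFunctionFinEquiv.symm s))
    (fun i s => hden _ _) (fun i s => hnum _ _)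
  have hnum' : ∀ (i : Fin k) (s : Fin (n ^ k)),
      I.num i s = num i (finFunctionFinEquiv.symm s) := fun i s => dif_pos ⟨i.2, s.2⟩
  have hden' : ∀ (i : Fin k) (s : Fin (n ^ k)),
      I.den i s = den i (finFunctionFinEquiv.symm s) := fun i s => dif_pos ⟨i.2, s.2⟩
  have hdata' : I.gameData = .pair (.nat k) (.pair (.nat n) (.list (List.ofFn fun i : Fin k =>
      .list (List.ofFn fun l : Fin (n ^ k) => entry i (finFunctionFinEquiv.symm l))))) := by
    change Data.pair (.nat k) (.pair (.nat n) (.list (List.ofFn fun i : Fin k =>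
      .list (List.ofFn fun l : Fin (n ^ k) => .pair (.nat (I.num i l)) (.nat (I.den i l)))))) = _
    simp only [hnum', hden', hdata]
  rw [← hdata']
  have hH : (I.H : ℝ) = G.entries * 2 ^ accuracyBits ε := by
    change ((k * n ^ k * 2 ^ accuracyBits ε : ℕ) : ℝ) = ((k * n ^ k : ℕ) : ℝ) * _
    push_cast
    rfl
  have hent : (0 : ℝ) < G.entries := by
    have : 0 < k * n ^ k := Nat.mul_pos hk (pow_pos hn _)
    exact_mod_cast this
  have h2 : (0 : ℝ) < 2 ^ accuracyBits ε := by positivity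
  have hlow := one_div_two_pow_accuracyBits_le hε
  refine ⟨I.N, I.bimatrixGame, 1 / (2 ^ 33 * (I.H : ℚ) ^ 8), I.mapping, I.bimatrixData,
    I.accuracyData, τ I, I.isGameCode_bimatrixData, I.isRatCode_accuracyData, hP I, hT I,
    ?_, ?_, ?_⟩
  · push_cast
    have h1 : (ε / (G.entries : ℝ)) ^ 8 ≤ (2 / I.H) ^ 8 := by
      refine pow_le_pow_left₀ (by positivity) ?_ 8
      rw [hH, mul_comm, ← div_div]
      gcongr
      exact le_two_div_two_pow_accuracyBits hε hε'
    calc (1 : ℝ) / 2 ^ 41 * (ε / (G.entries : ℝ)) ^ 8 ≤ 1 / 2 ^ 41 * (2 / I.H) ^ 8 := by gcongr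
      _ = 1 / (2 ^ 33 * (I.H : ℝ) ^ 8) := by
        have : (I.H : ℝ) ≠ 0 := by rw [hH]; positivity
        field_simp
  · push_cast
    have h1 : (1 / (I.H : ℝ)) ^ 8 ≤ (ε / (G.entries : ℝ)) ^ 8 := by
      refine pow_le_pow_left₀ (by positivity) ?_ 8
      rw [hH, mul_comm, ← div_div]
      gcongr
    have hI : (0 : ℝ) < I.H := by rw [hH]; positivity
    refine le_trans ?_ h1
    rw [one_div_pow]
    exact one_div_le_one_div_of_le (by positivity) (le_mul_of_one_le_left (by positivity)
      (by norm_num))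
  · have h := GameInstance.isDirectReduction_mapping (I := I) G (fun i s => by
      rw [hnum' i s, hden' i s]
      exact hpay _ _) hlow
    push_cast
    exact h
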